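/- Let $n\ge 3$ and let $H$ be the free abelian group on $x_1,\dots,x_n$, with dual basis $x_1^*,\dots,x_n^*$ of $H^*$. Let $\mathcal L_n=\bigoplus_{k\ge1}\mathcal L_n(k)$ be the free Lie algebra over $\mathbb Z$ on $x_1,\dots,x_n$, graded by bracket length, and write $[a_1,\dots,a_k]=[[\cdots[a_1,a_2],\cdots],a_k]$. For $a\in\mathcal L_n$ let $x_i^*\otimes a$ be the derivation of $\mathcal L_n$ with $x_i\mapsto a$ and $x_j\mapsto 0$ for $j\ne i$. For $k\ge1$ let $\mathfrak b_n(k)$ be the group of derivations $f$ of $\mathcal L_n$ such that $f(x_i)\in[\mathcal L_n(k),x_i]$ for all $i$ and $\sum_{i=1}^n f(x_i)=0$. Then $\mathfrak b_n=\bigoplus_{k\ge1}\mathfrak b_n(k)$ is a graded Lie algebra (the special derivations), $H_1(\mathfrak b_n,\mathbb Z)=\mathfrak b_n/[\mathfrak b_n,\mathfrak b_n]$ is its abelianization, and $H_1(\mathfrak b_n,\mathbb Z)_k$ is the image of $\mathfrak b_n(k)$ in it. For $f\in\mathfrak b_n(k)$ the Morita trace $\mathrm{MT}_k^B(f)\in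 S^kH$ is obtained by writing $f(x_i)\in\mathcal L_n(k+1)\subset H^{\otimes(k+1)}$, contracting the first tensor factor of $f(x_i)$ with $x_i^*$, summing over $i$, and projecting $H^{\otimes k}\to S^kH$. Let $P_n$ be the pure braid group, viewed as the group of automorphisms of the free group $F_n$ on $x_1,\dots,x_n$ that send every $x_i$ to a conjugate of $x_i$ and fix the product $x_1x_2\cdots x_n$. The first Johnson homomorphism $\tau_1^B:P_n\to\mathrm{Hom}(H,\mathcal L_n(2))$ is $\sigma\mapsto(x\mapsto x^{-1}\sigma(x))$, where $\mathcal L_n(2)$ is identified with the quotient $\Gamma_n(2)/\Gamma_n(3)$ of the lower central series of $F_n$. **Theorem.** Let $n\ge 3$. 1. The homomorphism $\Theta$ on $\mathfrak b_n$ that is the identity in degree $1$ and $\mathrm{MT}_k^B$ in each degree $k\ge2$ induces a surjective homomorphism of abelian Lie algebras $$\overline{\Theta|_{\mathfrak b_n}}:H_1(\mathfrak b_n,\mathbb Z)\longrightarrow \mathrm{Im}(\tau_1^B)\oplus\bigoplus_{m\ge1}\mathrm{Im}(\mathrm{MT}_{2m+1}^B),$$ and this homomorphism is not injective. 2. Put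 $$\begin{aligned}\mathbf b(i,j,l,p,q,r)={}&x_i^*\otimes[x_r,x_q,x_p,x_l,x_j,x_i]-x_j^*\otimes[x_r,x_q,x_p,x_l,x_i,x_j]-x_l^*\otimes[x_r,x_q,x_p,[x_j,x_i],x_l]\\&-x_p^*\otimes[x_i,x_j,x_l,[x_q,x_r],x_p]-x_q^*\otimes[x_i,x_j,x_l,x_p,x_r,x_q]+x_r^*\otimes[x_i,x_j,x_l,x_p,x_q,x_r].\end{aligned}$$ The element $\mathbf n(1,2,3)=\mathbf b(3,2,1,3,2,1)-\mathbf b(3,2,3,1,2,1)$ lies in $\mathfrak b_n(5)$, is nonzero, satisfies $\mathrm{MT}_5^B(\mathbf n(1,2,3))=0$, and does not lie in $[\mathfrak b_n(4),\mathfrak b_n(1)]$, the subgroup generated by the brackets $[f,g]$ with $f\in\mathfrak b_n(4)$ and $g\in\mathfrak b_n(1)$. 3. One has $[\mathfrak b_n(4),\mathfrak b_n(1)]\subset\mathfrak b_n(5)$, and the natural map $\mathfrak b_n(5)\to H_1(\mathfrak b_n,\mathbb Z)_5$ induces an isomorphism $\mathfrak b_n(5)/[\mathfrak b_n(4),\mathfrak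 b_n(1)]\cong H_1(\mathfrak b_n,\mathbb Z)_5$. -/

import Mathlib

noncomputable section

namespace SpecialDer

open scoped TensorProduct commutatorElement

/-! ### The free Lie ring and its grading -/

/-- The free Lie algebra `𝓛ₙ` over `R` on `x₁, …, xₙ` (indexed by `Fin n`). -/
abbrev FreeLie (R : Type*) [CommRing R] (n : ℕ) : Type _ := FreeLieAlgebra R (Fin n)

/-- The generator `xᵢ`. -/
abbrev gen (R : Type*) [CommRing R] {n : ℕ} (i : Fin n) : FreeLie R n := FreeLieAlgebra.of R i

/-- The left-normed bracket `[a₁, a₂, …, aₖ] = [[⋯[[a₁, a₂], a₃], ⋯], aₖ]`. -/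
def leftNormed {L : Type*} [LieRing L] : List L → L
  | [] => 0
  | a :: l => l.foldl (fun u v => ⁅u, v⁆) a

/-- The degree `k` part `𝓛ₙ(k)`, spanned by the left-normed brackets of `k` generators. -/
def freeLiePart (R : Type*) [CommRing R] (n k : ℕ) : Submodule R (FreeLie R n) :=
  Submodule.span R {a | ∃ w : List (Fin n), w.length = k ∧ a = leftNormed (w.map (gen R))}

theorem lie_gen_mem {R : Type*} [CommRing R] {n k : ℕ} {a : FreeLie R n} (ha : a ∈ freeLiePart R n k) (i : Fin n) :
    ⁅a, gen R i⁆ ∈ freeLiePart R n (k + 1) := by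
  induction ha using Submodule.span_induction with
  | mem x hx =>
    obtain ⟨w, hw, rfl⟩ := hx
    cases w with
    | nil => simp [leftNormed]
    | cons j t =>
      refine Submodule.subset_span ⟨(j :: t) ++ [i], by simp [← hw], ?_⟩
      simp [leftNormed]
  | zero => simp
  | add x y _ _ hx hy => rw [add_lie]; exact add_mem hx hy
  | smul t x _ hx => rw [smul_lie]; exact Submodule.smul_mem _ _ hx

theorem gen_mem {R : Type*} [CommRing R] {n : ℕ} (i : Fin n) : gen R i ∈ freeLiePart R n 1 :=
  Submodule.subset_span ⟨[i], rfl, by simp [leftNormed]⟩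

theorem freeLiePart_induction {R : Type*} [CommRing R] {n : ℕ} {P : ℕ → FreeLie R n → Prop}
    (zero : ∀ k, P k 0) (add : ∀ k a b, P k a → P k b → P k (a + b))
    (smul : ∀ k (t : R) a, P k a → P k (t • a)) (of : ∀ i, P 1 (gen R i))
    (lie : ∀ k a i, a ∈ freeLiePart R n k → P k a → P (k + 1) ⁅a, gen R i⁆)
    {k : ℕ} {a : FreeLie R n} (ha : a ∈ freeLiePart R n k) : P k a := by
  have key : ∀ w : List (Fin n), P w.length (leftNormed (w.map (gen R))) ∧
      leftNormed (w.map (gen R)) ∈ freeLiePart R n w.length := by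
    intro w
    induction w using List.reverseRecOn with
    | nil => exact ⟨by simpa [leftNormed] using zero 0, by simp [leftNormed]⟩
    | append_singleton w i ih =>
      cases w with
      | nil => exact ⟨by simpa [leftNormed] using of i, Submodule.subset_span ⟨[i], rfl, rfl⟩⟩
      | cons j t =>
        refine ⟨?_, Submodule.subset_span ⟨_, rfl, rfl⟩⟩
        have h := lie _ _ i ih.2 ih.1
        simpa [leftNormed] using h
  induction ha using Submodule.span_induction with
  | mem x hx =>
    obtain ⟨w, rfl, rfl⟩ := hx
    exact (key w).1
  | zero => exact zero k
  | add x y _ _ hx hy => exact add k x y hx hy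
  | smul t x _ hx => exact smul k t x hx

theorem lie_mem {R : Type*} [CommRing R] {n k l : ℕ} {a b : FreeLie R n} (ha : a ∈ freeLiePart R n k)
    (hb : b ∈ freeLiePart R n l) : ⁅a, b⁆ ∈ freeLiePart R n (k + l) := by
  have : ∀ k, ∀ a ∈ freeLiePart R n k, ⁅a, b⁆ ∈ freeLiePart R n (k + l) := by
    refine freeLiePart_induction
      (P := fun l b => ∀ k, ∀ a ∈ freeLiePart R n k, ⁅a, b⁆ ∈ freeLiePart R n (k + l))
      ?_ ?_ ?_ ?_ ?_ hb
    · intro l k a _; simp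
    · intro l b c hb hc k a ha; rw [lie_add]; exact add_mem (hb k a ha) (hc k a ha)
    · intro l t b hb k a ha; rw [lie_smul]; exact Submodule.smul_mem _ _ (hb k a ha)
    · intro i k a ha; exact lie_gen_mem ha i
    · intro l b i _ hb k a ha
      have h1 := lie_gen_mem (hb k a ha) i
      have h2 := hb _ _ (lie_gen_mem ha i)
      have e : ⁅a, ⁅b, gen R i⁆⁆ = ⁅⁅a, b⁆, gen R i⁆ - ⁅⁅a, gen R i⁆, b⁆ := by
        rw [leibniz_lie, ← lie_skew ⁅a, gen R i⁆ b]; abel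
      rw [e]
      refine sub_mem h1 ?_
      have e2 : k + 1 + l = k + (l + 1) := by omega
      rwa [e2] at h2
  exact this k a ha

/-! ### Polynomial families of elements of `𝓛ₙ`

`R[t] ⊗ 𝓛ₙ` is used to define the homogeneous components of an element of `𝓛ₙ` and to extend a
map on generators to a derivation. -/

/-- The coefficient of `t ^ m` of an element of `R[t] ⊗ 𝓛ₙ`. -/
def coeffL (R : Type*) [CommRing R] (n m : ℕ) : (Polynomial R ⊗[R] FreeLie R n) →ₗ[R] FreeLie R n :=
  (TensorProduct.lid R (FreeLie R n)).toLinearMap ∘ₗ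
    LinearMap.rTensor (FreeLie R n) (Polynomial.lcoeff R m)

theorem coeffL_tmul {R : Type*} [CommRing R] (n m : ℕ) (p : Polynomial R) (a : FreeLie R n) :
    coeffL R n m (p ⊗ₜ a) = p.coeff m • a := by
  simp [coeffL]

theorem coeffL_lie {R : Type*} [CommRing R] (n m : ℕ) (u v : Polynomial R ⊗[R] FreeLie R n) :
    coeffL R n m ⁅u, v⁆ =
      ∑ q ∈ Finset.HasAntidiagonal.antidiagonal m, ⁅coeffL R n q.1 u, coeffL R n q.2 v⁆ := by
  induction u using TensorProduct.induction_on with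
  | zero =>
    rw [show ⁅(0 : Polynomial R ⊗[R] FreeLie R n), v⁆ = 0 from zero_lie v]
    simp only [map_zero, zero_lie, Finset.sum_const_zero]
  | add x y hx hy =>
    rw [show ⁅x + y, v⁆ = ⁅x, v⁆ + ⁅y, v⁆ from add_lie x y v]
    simp only [map_add, hx, hy, add_lie, Finset.sum_add_distrib]
  | tmul p a =>
    induction v using TensorProduct.induction_on with
    | zero =>
      rw [show ⁅p ⊗ₜ[R] a, (0 : Polynomial R ⊗[R] FreeLie R n)⁆ = 0 from lie_zero (p ⊗ₜ[R] a)]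
      simp only [map_zero, lie_zero, Finset.sum_const_zero]
    | add x y hx hy =>
      rw [show ⁅p ⊗ₜ[R] a, x + y⁆ = ⁅p ⊗ₜ[R] a, x⁆ + ⁅p ⊗ₜ[R] a, y⁆ from lie_add (p ⊗ₜ[R] a) x y]
      simp only [map_add, hx, hy, lie_add, Finset.sum_add_distrib]
    | tmul r b =>
      rw [LieAlgebra.ExtendScalars.bracket_tmul, coeffL_tmul, Polynomial.coeff_mul,
        Finset.sum_smul]
      refine Finset.sum_congr rfl fun q _ => ?_
      rw [coeffL_tmul, coeffL_tmul, smul_lie, lie_smul, smul_smul]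

/-- The projection of `𝓛ₙ` to its degree `m` part: the coefficient of `t ^ m` after the
substitution `xᵢ ↦ t xᵢ`. -/
def freeLieProj (R : Type*) [CommRing R] (n m : ℕ) : FreeLie R n →ₗ[R] FreeLie R n :=
  coeffL R n m ∘ₗ (FreeLieAlgebra.lift R (fun i : Fin n =>
    (Polynomial.X : Polynomial R) ⊗ₜ[R] gen R i) :
      FreeLie R n →ₗ⁅R⁆ Polynomial R ⊗[R] FreeLie R n).toLinearMap

theorem freeLieProj_apply_of_mem {R : Type*} [CommRing R] {n m k : ℕ} {a : FreeLie R n} (ha : a ∈ freeLiePart R n k) :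
    freeLieProj R n m a = if k = m then a else 0 := by
  have h : (FreeLieAlgebra.lift R (fun i : Fin n =>
      (Polynomial.X : Polynomial R) ⊗ₜ[R] gen R i) :
        FreeLie R n →ₗ⁅R⁆ Polynomial R ⊗[R] FreeLie R n) a
      = (Polynomial.X ^ k : Polynomial R) ⊗ₜ[R] a := by
    refine freeLiePart_induction (P := fun k a => (FreeLieAlgebra.lift R (fun i : Fin n =>
      (Polynomial.X : Polynomial R) ⊗ₜ[R] gen R i) :
        FreeLie R n →ₗ⁅R⁆ Polynomial R ⊗[R] FreeLie R n) a
      = (Polynomial.X ^ k : Polynomial R) ⊗ₜ[R] a) ?_ ?_ ?_ ?_ ?_ ha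
    · intro k; simp
    · intro k a b h1 h2; rw [map_add, h1, h2, TensorProduct.tmul_add]
    · intro k t a h1; rw [map_smul, h1, TensorProduct.tmul_smul]
    · intro i; rw [FreeLieAlgebra.lift_of_apply, pow_one]
    · intro k a i _ h1
      rw [LieHom.map_lie, h1, FreeLieAlgebra.lift_of_apply,
        LieAlgebra.ExtendScalars.bracket_tmul, pow_succ]
  have h2 : freeLieProj R n m a = coeffL R n m ((Polynomial.X ^ k : Polynomial R) ⊗ₜ[R] a) := by
    rw [← h]; rfl
  rw [h2, coeffL_tmul, Polynomial.coeff_X_pow]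
  by_cases hk : k = m
  · simp [hk]
  · rw [if_neg (Ne.symm hk), if_neg hk, zero_smul]

/-! ### Derivations of `𝓛ₙ` -/

/-- `Der(𝓛ₙ)`. -/
abbrev FreeLieDer (R : Type*) [CommRing R] (n : ℕ) : Type _ := LieDerivation R (FreeLie R n) (FreeLie R n)

/-- The Lie algebra map `𝓛ₙ → R[t] ⊗ 𝓛ₙ`, `xᵢ ↦ xᵢ + t cᵢ`. -/
def deform {R : Type*} [CommRing R] {n : ℕ} (c : Fin n → FreeLie R n) : FreeLie R n →ₗ⁅R⁆ Polynomial R ⊗[R] FreeLie R n :=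
  FreeLieAlgebra.lift R (fun i : Fin n =>
    (1 : Polynomial R) ⊗ₜ[R] gen R i + (Polynomial.X : Polynomial R) ⊗ₜ[R] c i)

theorem coeffL_zero_deform {R : Type*} [CommRing R] {n : ℕ} (c : Fin n → FreeLie R n) (a : FreeLie R n) :
    coeffL R n 0 (deform c a) = a := by
  let φ : FreeLie R n →ₗ⁅R⁆ FreeLie R n :=
    { toLinearMap := coeffL R n 0 ∘ₗ (deform c).toLinearMap
      map_lie' := by
        intro x y
        change coeffL R n 0 (deform c ⁅x, y⁆) = ⁅coeffL R n 0 (deform c x), coeffL R n 0 (deform c y)⁆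
        rw [LieHom.map_lie, coeffL_lie]; simp }
  have h : φ = LieHom.id := by
    refine FreeLieAlgebra.hom_ext fun i => ?_
    change coeffL R n 0 (deform c (gen R i)) = gen R i
    rw [deform, FreeLieAlgebra.lift_of_apply, map_add, coeffL_tmul, coeffL_tmul]
    simp
  exact congrArg (fun ψ : FreeLie R n →ₗ⁅R⁆ FreeLie R n => ψ a) h

/-- The unique derivation of `𝓛ₙ` with `xᵢ ↦ cᵢ` for all `i`. -/
def derOfGen {R : Type*} [CommRing R] {n : ℕ} (c : Fin n → FreeLie R n) : FreeLieDer R n where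
  toLinearMap := coeffL R n 1 ∘ₗ (deform c).toLinearMap
  leibniz' a b := by
    change coeffL R n 1 (deform c ⁅a, b⁆) =
      ⁅a, coeffL R n 1 (deform c b)⁆ - ⁅b, coeffL R n 1 (deform c a)⁆
    rw [LieHom.map_lie, coeffL_lie, ← lie_skew b]
    simp [Finset.Nat.antidiagonal_succ, coeffL_zero_deform, sub_eq_add_neg]

theorem derOfGen_gen {R : Type*} [CommRing R] {n : ℕ} (c : Fin n → FreeLie R n) (i : Fin n) :
    derOfGen c (gen R i) = c i := by
  change coeffL R n 1 (deform c (gen R i)) = c i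
  rw [deform, FreeLieAlgebra.lift_of_apply, map_add, coeffL_tmul, coeffL_tmul]
  simp [Polynomial.coeff_one]

/-- The derivation `xᵢ* ⊗ a`, sending `xᵢ` to `a` and the other generators to `0`. -/
def dualTensor {R : Type*} [CommRing R] {n : ℕ} (i : Fin n) (a : FreeLie R n) : FreeLieDer R n := derOfGen (Pi.single i a)

/-! ### Tangential and special derivations -/

/-- `𝔭ₙ(k)`: the derivations `f` with `f(xᵢ) ∈ [𝓛ₙ(k), xᵢ]` for all `i`, that is, the span of the
`xᵢ* ⊗ [x_{j₁}, …, x_{jₖ}, xᵢ]`. -/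
def tangentialPart (R : Type*) [CommRing R] (n k : ℕ) : Submodule R (FreeLieDer R n) where
  carrier := {f | ∀ i, ∃ c ∈ freeLiePart R n k, f (gen R i) = ⁅c, gen R i⁆}
  add_mem' := by
    intro f g hf hg i
    obtain ⟨c, hc, h1⟩ := hf i
    obtain ⟨d, hd, h2⟩ := hg i
    exact ⟨c + d, add_mem hc hd, by rw [LieDerivation.add_apply, h1, h2, add_lie]⟩
  zero_mem' := fun i => ⟨0, zero_mem _, by simp⟩
  smul_mem' := by
    intro t f hf i
    obtain ⟨c, hc, h1⟩ := hf i
    exact ⟨t • c, Submodule.smul_mem _ _ hc, by rw [LieDerivation.smul_apply, h1, smul_lie]⟩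

/-- `𝔟ₙ(k)`: the elements `f` of `𝔭ₙ(k)` with `∑ᵢ f(xᵢ) = 0`. -/
def specialPart (R : Type*) [CommRing R] (n k : ℕ) : Submodule R (FreeLieDer R n) where
  carrier := {f | f ∈ tangentialPart R n k ∧ ∑ i, f (gen R i) = 0}
  add_mem' := by
    rintro f g ⟨hf, hf'⟩ ⟨hg, hg'⟩
    exact ⟨add_mem hf hg, by
      simp only [LieDerivation.add_apply, Finset.sum_add_distrib, hf', hg', add_zero]⟩
  zero_mem' := ⟨zero_mem _, by simp⟩
  smul_mem' := by
    rintro t f ⟨hf, hf'⟩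
    exact ⟨Submodule.smul_mem _ _ hf, by
      simp only [LieDerivation.smul_apply, ← Finset.smul_sum, hf', smul_zero]⟩

theorem tangential_apply_mem {R : Type*} [CommRing R] {n k m : ℕ} {f : FreeLieDer R n} (hf : f ∈ tangentialPart R n k)
    {a : FreeLie R n} (ha : a ∈ freeLiePart R n m) : f a ∈ freeLiePart R n (m + k) := by
  refine freeLiePart_induction (P := fun m a => f a ∈ freeLiePart R n (m + k)) ?_ ?_ ?_ ?_ ?_ ha
  · intro m; simp
  · intro m a b h1 h2; rw [map_add]; exact add_mem h1 h2
  · intro m t a h1; rw [map_smul]; exact Submodule.smul_mem _ _ h1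
  · intro i
    obtain ⟨c, hc, h1⟩ := hf i
    rw [h1, add_comm]; exact lie_gen_mem hc i
  · intro m a i ha h1
    obtain ⟨c, hc, h2⟩ := hf i
    rw [LieDerivation.apply_lie_eq_add, h2]
    refine add_mem ?_ ?_
    · have := lie_mem ha (lie_gen_mem hc i)
      rwa [show m + (k + 1) = m + 1 + k by omega] at this
    · have := lie_gen_mem h1 i
      rwa [show m + k + 1 = m + 1 + k by omega] at this

theorem lie_specialPart_mem {R : Type*} [CommRing R] {n k l : ℕ} {f g : FreeLieDer R n} (hf : f ∈ specialPart R n k)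
    (hg : g ∈ specialPart R n l) : ⁅f, g⁆ ∈ specialPart R n (k + l) := by
  refine ⟨fun i => ?_, ?_⟩
  · obtain ⟨c, hc, h1⟩ := hf.1 i
    obtain ⟨d, hd, h2⟩ := hg.1 i
    refine ⟨f d - g c + ⁅d, c⁆, ?_, ?_⟩
    · refine add_mem (sub_mem ?_ (tangential_apply_mem hg.1 hc)) ?_
      · rw [add_comm]; exact tangential_apply_mem hf.1 hd
      · rw [add_comm]; exact lie_mem hd hc
    · rw [LieDerivation.commutator_apply, h1, h2, LieDerivation.apply_lie_eq_add,
        LieDerivation.apply_lie_eq_add, h1, h2, add_lie, sub_lie, lie_lie d c]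
      abel
  · simp only [LieDerivation.commutator_apply, Finset.sum_sub_distrib, ← map_sum, hf.2, hg.2,
      map_zero, sub_zero]

theorem lie_iSup_specialPart_mem {R : Type*} [CommRing R] {n : ℕ} {f g : FreeLieDer R n}
    (hf : f ∈ ⨆ k : ℕ, specialPart R n (k + 1)) (hg : g ∈ ⨆ k : ℕ, specialPart R n (k + 1)) :
    ⁅f, g⁆ ∈ ⨆ k : ℕ, specialPart R n (k + 1) := by
  refine Submodule.iSup_induction (fun k : ℕ => specialPart R n (k + 1))
    (motive := fun f => ⁅f, g⁆ ∈ ⨆ k : ℕ, specialPart R n (k + 1)) hf ?_ ?_ ?_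
  · intro k f hf
    refine Submodule.iSup_induction (fun k : ℕ => specialPart R n (k + 1))
      (motive := fun g => ⁅f, g⁆ ∈ ⨆ k : ℕ, specialPart R n (k + 1)) hg ?_ ?_ ?_
    · intro l g hg
      have h := lie_specialPart_mem hf hg
      rw [show k + 1 + (l + 1) = k + 1 + l + 1 by omega] at h
      exact Submodule.mem_iSup_of_mem (p := fun k : ℕ => specialPart R n (k + 1)) (k + 1 + l) h
    · rw [lie_zero]; exact zero_mem _
    · intro x y hx hy; rw [lie_add]; exact add_mem hx hy
  · rw [zero_lie]; exact zero_mem _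
  · intro x y hx hy; rw [add_lie]; exact add_mem hx hy

/-- The Lie algebra of special derivations `𝔟ₙ = ⨁_{k ≥ 1} 𝔟ₙ(k)`. -/
def special (R : Type*) [CommRing R] (n : ℕ) : LieSubalgebra R (FreeLieDer R n) where
  toSubmodule := ⨆ k : ℕ, specialPart R n (k + 1)
  lie_mem' hf hg := lie_iSup_specialPart_mem hf hg

theorem specialPart_le {R : Type*} [CommRing R] (n k : ℕ) (hk : 1 ≤ k) :
    specialPart R n k ≤ (special R n).toSubmodule := by
  obtain ⟨m, rfl⟩ : ∃ m, k = m + 1 := ⟨k - 1, by omega⟩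
  exact le_iSup (fun k : ℕ => specialPart R n (k + 1)) m

/-- `[𝔟ₙ(k), 𝔟ₙ(l)]`, the additive group generated by the brackets. -/
def bracketSpan (R : Type*) [CommRing R] (n k l : ℕ) : Submodule R (FreeLieDer R n) :=
  Submodule.span R {h | ∃ f ∈ specialPart R n k, ∃ g ∈ specialPart R n l, h = ⁅f, g⁆}

/-- The commutator ideal `[𝔟ₙ, 𝔟ₙ]`. -/
abbrev specialCommutator (R : Type*) [CommRing R] (n : ℕ) : LieIdeal R (special R n) :=
  ⁅(⊤ : LieIdeal R (special R n)), (⊤ : LieIdeal R (special R n))⁆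

/-- `H₁(𝔟ₙ, R)`, the abelianization of `𝔟ₙ`. -/
abbrev H1 (R : Type*) [CommRing R] (n : ℕ) : Type _ := special R n ⧸ specialCommutator R n

/-- The class of an element of `𝔟ₙ` in `H₁(𝔟ₙ, R)`. -/
def toH1 (R : Type*) [CommRing R] (n : ℕ) : special R n →ₗ[R] H1 R n :=
  (LieSubmodule.Quotient.mk' (specialCommutator R n) :
    special R n →ₗ⁅R, special R n⁆ H1 R n).toLinearMap

/-- The natural map `𝔟ₙ(k) → H₁(𝔟ₙ, R)`, for `k ≥ 1`. -/
def partToH1 (R : Type*) [CommRing R] (n k : ℕ) (hk : 1 ≤ k) : specialPart R n k →ₗ[R] H1 R n :=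
  toH1 R n ∘ₗ Submodule.inclusion (specialPart_le n k hk)

/-- The degree `k` part `H₁(𝔟ₙ, R)ₖ`, for `k ≥ 1`. -/
def H1Part (R : Type*) [CommRing R] (n k : ℕ) (hk : 1 ≤ k) : Submodule R (H1 R n) := LinearMap.range (partToH1 R n k hk)

/-! ### Morita traces -/

section Trace

attribute [local instance 100] LieRing.ofAssociativeRing

/-- The natural Lie algebra map `𝓛ₙ → T(H)`, where `T(H)` is the free associative ring on
`x₁, …, xₙ`. -/
def toTensor (R : Type*) [CommRing R] (n : ℕ) : FreeLie R n →ₗ⁅R⁆ FreeAlgebra R (Fin n) :=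
  FreeLieAlgebra.lift R (FreeAlgebra.ι R)

end Trace

/-- The contraction of the first tensor factor with `xᵢ*`: a monomial
`x_{j₁} ⊗ x_{j₂} ⊗ ⋯ ⊗ x_{jₘ}` is sent to `xᵢ*(x_{j₁}) x_{j₂} ⊗ ⋯ ⊗ x_{jₘ}`. -/
def contractFirst {R : Type*} [CommRing R] {n : ℕ} (i : Fin n) : FreeAlgebra R (Fin n) →ₗ[R] FreeAlgebra R (Fin n) :=
  (FreeAlgebra.basisFreeMonoid R (Fin n)).constr R fun w : FreeMonoid (Fin n) =>
    match w.toList with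
    | [] => 0
    | j :: t => if j = i then (t.map (FreeAlgebra.ι R)).prod else 0

/-- The projection `T(H) → S(H)` to the symmetric algebra `S(H) = R[x₁, …, xₙ]`. -/
def toSym (R : Type*) [CommRing R] (n : ℕ) : FreeAlgebra R (Fin n) →ₐ[R] MvPolynomial (Fin n) R :=
  FreeAlgebra.lift R MvPolynomial.X

/-- The Morita trace: `f = ∑ᵢ xᵢ* ⊗ f(xᵢ)` is contracted and projected to `S(H)`. On derivations of
degree `k` this is `MTₖ`, with values in the homogeneous polynomials of degree `k`. -/
def moritaTrace (R : Type*) [CommRing R] (n : ℕ) : FreeLieDer R n →ₗ[R] MvPolynomial (Fin n) R where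
  toFun f := toSym R n (∑ i, contractFirst i (toTensor R n (f (gen R i))))
  map_add' f g := by simp [Finset.sum_add_distrib]
  map_smul' t f := by simp [← Finset.smul_sum]

/-- `Im(MTₖᴮ)`, the image of `𝔟ₙ(k)` under the Morita trace. -/
def imMT (R : Type*) [CommRing R] (n k : ℕ) : Submodule R (MvPolynomial (Fin n) R) := (specialPart R n k).map (moritaTrace R n)

/-! ### The first Johnson homomorphism of the braid group -/

/-- `Represents n k w a`: the element `w` lies in `Γₙ(k)`, and its class in `Γₙ(k) / Γₙ(k + 1)` is
`a ∈ 𝓛ₙ(k)` under the isomorphism of `gr(Fₙ)` (whose bracket is induced by the group commutator)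
with the free Lie algebra that takes the class of `xᵢ` to `xᵢ`. Here `Γₙ(k)` is
`lowerCentralSeries ⊤ (k - 1)`, since Mathlib's series starts at `0`. -/
inductive Represents (n : ℕ) : ℕ → FreeGroup (Fin n) → FreeLie ℤ n → Prop
  | of (i : Fin n) : Represents n 1 (FreeGroup.of i) (gen ℤ i)
  | ker (k : ℕ) (hk : 1 ≤ k) (w : FreeGroup (Fin n))
      (hw : w ∈ (⊤ : Subgroup (FreeGroup (Fin n))).lowerCentralSeries k) : Represents n k w 0
  | mul (k : ℕ) (v w : FreeGroup (Fin n)) (a b : FreeLie ℤ n) :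
      Represents n k v a → Represents n k w b → Represents n k (v * w) (a + b)
  | inv (k : ℕ) (v : FreeGroup (Fin n)) (a : FreeLie ℤ n) :
      Represents n k v a → Represents n k v⁻¹ (-a)
  | comm (k l : ℕ) (v w : FreeGroup (Fin n)) (a b : FreeLie ℤ n) :
      Represents n k v a → Represents n l w b → Represents n (k + l) ⁅v, w⁆ ⁅a, b⁆

/-- The pure braid group `Pₙ = Bₙ ∩ IAₙ`, inside `Aut(Fₙ)`: the automorphisms that conjugate each
generator and fix the product `x₁ x₂ ⋯ xₙ`. -/
def pureBraid (n : ℕ) : Subgroup (MulAut (FreeGroup (Fin n))) where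
  carrier := {σ | (∀ i, ∃ c, σ (FreeGroup.of i) = c * FreeGroup.of i * c⁻¹) ∧
    σ (List.ofFn fun i : Fin n => FreeGroup.of i).prod =
      (List.ofFn fun i : Fin n => FreeGroup.of i).prod}
  mul_mem' := by
    rintro σ τ ⟨h1, h2⟩ ⟨h3, h4⟩
    refine ⟨fun i => ?_, by rw [MulAut.mul_apply, h4, h2]⟩
    obtain ⟨c, hc⟩ := h1 i
    obtain ⟨d, hd⟩ := h3 i
    exact ⟨σ d * c, by rw [MulAut.mul_apply, hd, map_mul, map_mul, map_inv, hc]; group⟩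
  one_mem' := ⟨fun i => ⟨1, by simp⟩, by simp⟩
  inv_mem' := by
    rintro σ ⟨h1, h2⟩
    refine ⟨fun i => ?_, by rw [MulAut.inv_apply, MulEquiv.symm_apply_eq, h2]⟩
    obtain ⟨c, hc⟩ := h1 i
    refine ⟨(σ⁻¹ c)⁻¹, ?_⟩
    have h : FreeGroup.of i = σ⁻¹ c * σ⁻¹ (FreeGroup.of i) * (σ⁻¹ c)⁻¹ := by
      have := congrArg (fun w => σ⁻¹ w) hc
      simpa using this
    nth_rewrite 2 [h]
    group

/-- The element `xᵢ⁻¹ σ(xᵢ)`. -/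
def displacement {n : ℕ} (σ : MulAut (FreeGroup (Fin n))) (i : Fin n) : FreeGroup (Fin n) :=
  (FreeGroup.of i)⁻¹ * σ (FreeGroup.of i)

theorem displacement_mem {n : ℕ} {σ : MulAut (FreeGroup (Fin n))} (hσ : σ ∈ pureBraid n)
    (i : Fin n) :
    displacement σ i ∈ (⊤ : Subgroup (FreeGroup (Fin n))).lowerCentralSeries 1 := by
  obtain ⟨c, hc⟩ := hσ.1 i
  rw [Subgroup.lowerCentralSeries_succ, Subgroup.lowerCentralSeries_zero, displacement, hc,
    show (FreeGroup.of i)⁻¹ * (c * FreeGroup.of i * c⁻¹) = ⁅(FreeGroup.of i)⁻¹, c⁆ by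
      rw [commutatorElement_def]; group]
  exact Subgroup.commutator_mem_commutator (Subgroup.mem_top _) (Subgroup.mem_top _)

theorem Represents.map {n : ℕ} {σ : MulAut (FreeGroup (Fin n))} (hσ : σ ∈ pureBraid n)
    {k : ℕ} {w : FreeGroup (Fin n)} {a : FreeLie ℤ n} (h : Represents n k w a) :
    Represents n k (σ w) a := by
  induction h with
  | of i =>
    have h1 := Represents.mul 1 _ _ _ _ (Represents.of i)
      (Represents.ker 1 le_rfl _ (displacement_mem hσ i))
    simpa [displacement] using h1
  | ker k hk w hw =>
    refine Represents.ker k hk _ ?_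
    have := Subgroup.characteristic_iff_le_comap.mp
      (inferInstance : ((⊤ : Subgroup (FreeGroup (Fin n))).lowerCentralSeries k).Characteristic)
      σ hw
    exact this
  | mul k v w a b _ _ h1 h2 => rw [map_mul]; exact Represents.mul k _ _ _ _ h1 h2
  | inv k v a _ h1 => rw [map_inv]; exact Represents.inv k _ _ h1
  | comm k l v w a b _ _ h1 h2 => rw [map_commutatorElement]; exact Represents.comm k l _ _ _ _ h1 h2

/-- `Im(τ₁ᴮ) ⊆ Hom(H, 𝓛ₙ(2))`, the image of the first Johnson homomorphism `σ ↦ (x ↦ x⁻¹ σ(x))`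
of the braid group; a homomorphism on `H` is given by its values on `x₁, …, xₙ`. -/
def imTauOne (n : ℕ) : AddSubgroup (Fin n → FreeLie ℤ n) :=
    { carrier := {y | ∃ σ ∈ pureBraid n, ∀ i, Represents n 2 (displacement σ i) (y i)}
      add_mem' := by
        rintro y z ⟨σ, hσ, h1⟩ ⟨τ, hτ, h2⟩
        refine ⟨σ * τ, mul_mem hσ hτ, fun i => ?_⟩
        have h := Represents.mul 2 _ _ _ _ (h1 i) ((h2 i).map hσ)
        simpa [displacement] using h
      zero_mem' := ⟨1, one_mem _, fun i => Represents.ker 2 (by norm_num) _ (by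
        simp [displacement, one_mem])⟩
      neg_mem' := by
        rintro y ⟨σ, hσ, h1⟩
        refine ⟨σ⁻¹, inv_mem hσ, fun i => ?_⟩
        have h := (Represents.inv 2 _ _ (h1 i)).map (inv_mem hσ)
        simpa [displacement] using h }

/-! ### The map `Θ` -/

/-- `Θ = id₁ ⊕ ⨁_{k ≥ 2} MTₖ`. The first component of `Θ f` is the degree one part of `f`, as an
element of `Hom(H, 𝓛ₙ(2))`; the second is the sum over `k ≥ 2` of the `MTₖ` of the degree `k` parts
of `f`, in `⨁_{k ≥ 2} SᵏH ⊆ S(H)`, that is, the Morita trace of `f` without its components of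
degrees `0` and `1`. -/
def Theta (R : Type*) [CommRing R] (n : ℕ) : FreeLieDer R n →ₗ[R] (Fin n → FreeLie R n) × MvPolynomial (Fin n) R where
  toFun f := (fun i => freeLieProj R n 2 (f (gen R i)),
    moritaTrace R n f - MvPolynomial.homogeneousComponent 0 (moritaTrace R n f)
      - MvPolynomial.homogeneousComponent 1 (moritaTrace R n f))
  map_add' f g := by
    refine Prod.ext ?_ ?_
    · funext i; simp
    · simp only [map_add, Prod.snd_add]; abel
  map_smul' t f := by
    refine Prod.ext ?_ ?_
    · funext i; simp
    · simp only [map_smul, Prod.smul_snd, smul_sub, RingHom.id_apply]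

/-- The target `Im(τ₁ᴮ) ⊕ ⨁_{m ≥ 1} Im(MTᴮ_{2m+1})`; the second summand is the internal direct sum,
in the graded ring `S(H)`, of subgroups of `S³H`, `S⁵H`, `S⁷H`, …. -/
def thetaTarget (n : ℕ) : AddSubgroup ((Fin n → FreeLie ℤ n) × MvPolynomial (Fin n) ℤ) :=
  (imTauOne n).prod (⨆ m : ℕ, imMT ℤ n (2 * (m + 1) + 1)).toAddSubgroup

/-! ### The explicit elements -/

/-- The derivation `𝐛(i, j, l, p, q, r)`. -/
def bElt (R : Type*) [CommRing R] {n : ℕ} (i j l p q r : Fin n) : FreeLieDer R n :=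
  dualTensor i (leftNormed [gen R r, gen R q, gen R p, gen R l, gen R j, gen R i])
    - dualTensor j (leftNormed [gen R r, gen R q, gen R p, gen R l, gen R i, gen R j])
    - dualTensor l (leftNormed [gen R r, gen R q, gen R p, ⁅gen R j, gen R i⁆, gen R l])
    - dualTensor p (leftNormed [gen R i, gen R j, gen R l, ⁅gen R q, gen R r⁆, gen R p])
    - dualTensor q (leftNormed [gen R i, gen R j, gen R l, gen R p, gen R r, gen R q])
    + dualTensor r (leftNormed [gen R i, gen R j, gen R l, gen R p, gen R q, gen R r])

/-- The derivation `𝐧(i, j, l) = 𝐛(l, j, i, l, j, i) - 𝐛(l, j, l, i, j, i)`. -/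
def nElt (R : Type*) [CommRing R] {n : ℕ} (i j l : Fin n) : FreeLieDer R n :=
  bElt R l j i l j i - bElt R l j l i j i

/-- The derivation `𝐧(1, 2, 3)` over `ℤ`; the generators `x₁, x₂, x₃` have the indices `0, 1, 2`. -/
def n123 (n : ℕ) (hn : 3 ≤ n) : FreeLieDer ℤ n :=
  nElt ℤ (⟨0, by omega⟩ : Fin n) ⟨1, by omega⟩ ⟨2, by omega⟩

end SpecialDer

end

/-! Everything rests on a free differential calculus in T(H). Write ∂ᵢ for `contractFirst i`, so
that u equals its constant term plus ∑ xᵢ ∂ᵢu, and set div f = ∑ ∂ᵢ(f(xᵢ)). For every linear τ on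
T(H) with τ(uv) = τ(vu), `trace_divergence_lie` gives τ(div [f,g]) = τ(f · div g) − τ(g · div f).
Two choices of τ are used.

For τ the projection to S(H), τ ∘ div is the Morita trace. A tangential f sends each xᵢ to a
commutator, so f acts by zero on S(H) and the trace kills brackets (`moritaTrace_lie`); hence Θ
descends to H₁. In even degree the trace vanishes because the antipode fixes ∂ᵢcᵢ when f(xᵢ) = [cᵢ,
xᵢ] and ∑ [cᵢ, xᵢ] = 0 (`moritaTrace_eq_zero_of_even`). Surjectivity then needs only Im(τ₁ᴮ) =
𝔟ₙ(1): representations in the Heisenberg group give one inclusion, explicit pure braids inducing the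
spanning elements t_{ij} give the other.

For τ = tr ∘ ρ, with ρ the 2 × 2 representation x₁ ↦ 1, x₂ ↦ E₁₂, x₃ ↦ E₂₁ and the other generators
↦ 0, each t_{ij} acts through ρ as an inner derivation. So τ ∘ div vanishes on [𝔟ₙ(k), 𝔟ₙ(1)]
(`testFunctional_lie`), yet it equals 2 on 𝐧(1,2,3), whose Morita trace is zero.

Finally, 𝔟ₙ(2) = [𝔟ₙ(1), 𝔟ₙ(1)] (`specialPart_two_le`), so by Jacobi [𝔟ₙ(3), 𝔟ₙ(2)] ⊂ [𝔟ₙ(4),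
𝔟ₙ(1)]. The degree 5 part of the commutator ideal is therefore [𝔟ₙ(4), 𝔟ₙ(1)]. This gives the third
claim, and it makes 𝐧(1,2,3) a nonzero class in the kernel of the induced map. -/

noncomputable section

namespace SpecialDer

open scoped TensorProduct commutatorElement

/-! ### Free differential calculus on T(H) and the divergence of a derivation -/

section Calculus

variable {R : Type*} [CommRing R] {n : ℕ}

/-- The elements satisfying `P` form a Lie subalgebra. By uniqueness in the universal property, the
map into it fixing the generators, followed by the inclusion, is the identity. -/
theorem FreeLie.induction {P : FreeLie R n → Prop} (zero : P 0)
    (add : ∀ a b, P a → P b → P (a + b)) (smul : ∀ (t : R) a, P a → P (t • a))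
    (of : ∀ i, P (gen R i)) (lie : ∀ a b, P a → P b → P ⁅a, b⁆) (a : FreeLie R n) : P a := by
  let S : LieSubalgebra R (FreeLie R n) :=
    { carrier := {a | P a}
      add_mem' := fun {a b} ha hb => add a b ha hb
      zero_mem' := zero
      smul_mem' := fun t a ha => smul t a ha
      lie_mem' := fun {a b} ha hb => lie a b ha hb }
  let φ : FreeLie R n →ₗ⁅R⁆ S := FreeLieAlgebra.lift R fun i => ⟨gen R i, of i⟩
  have h : S.incl.comp φ = LieHom.id := by
    refine FreeLieAlgebra.hom_ext fun i => ?_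
    simp [φ, LieHom.comp_apply, FreeLieAlgebra.lift_of_apply]
  have h2 : ((φ a : S) : FreeLie R n) = a :=
    congrArg (fun ψ : FreeLie R n →ₗ⁅R⁆ FreeLie R n => ψ a) h
  rw [← h2]
  exact (φ a).2

theorem der_ext {f g : FreeLieDer R n} (h : ∀ i, f (gen R i) = g (gen R i)) : f = g := by
  refine LieDerivation.ext fun a => ?_
  induction a using FreeLie.induction with
  | zero => simp
  | add a b ha hb => rw [map_add, map_add, ha, hb]
  | smul t a ha => rw [map_smul, map_smul, ha]
  | of i => exact h i
  | lie a b ha hb =>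
    rw [LieDerivation.apply_lie_eq_add, LieDerivation.apply_lie_eq_add, ha, hb]

theorem toTensor_gen (i : Fin n) : toTensor R n (gen R i) = FreeAlgebra.ι R i := by
  simp [toTensor, FreeLieAlgebra.lift_of_apply]

theorem toTensor_lie (a b : FreeLie R n) :
    toTensor R n ⁅a, b⁆ =
      toTensor R n a * toTensor R n b - toTensor R n b * toTensor R n a := by
  let _ : LieRing (FreeAlgebra R (Fin n)) := LieRing.ofAssociativeRing
  exact LieHom.map_lie (toTensor R n) a b

/-- The augmentation `T(H) → R`. -/
def aug (R : Type*) [CommRing R] (n : ℕ) : FreeAlgebra R (Fin n) →ₐ[R] R :=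
  FreeAlgebra.lift R 0

@[simp] theorem aug_ι (i : Fin n) : aug R n (FreeAlgebra.ι R i) = 0 := by simp [aug]

theorem aug_toTensor (a : FreeLie R n) : aug R n (toTensor R n a) = 0 := by
  induction a using FreeLie.induction with
  | zero => simp
  | add a b ha hb => simp [ha, hb]
  | smul t a ha => simp [ha]
  | of i => simp [toTensor_gen]
  | lie a b ha hb => rw [toTensor_lie, map_sub, map_mul, map_mul, ha, hb]; simp

theorem basisFreeMonoid_apply (w : FreeMonoid (Fin n)) :
    FreeAlgebra.basisFreeMonoid R (Fin n) w = (w.toList.map (FreeAlgebra.ι R)).prod := by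
  simp only [FreeAlgebra.basisFreeMonoid, Module.Basis.map_apply, Finsupp.coe_basisSingleOne]
  change FreeAlgebra.equivMonoidAlgebraFreeMonoid.symm (MonoidAlgebra.single w 1) = _
  simp [FreeAlgebra.equivMonoidAlgebraFreeMonoid, FreeMonoid.lift_apply]

theorem contractFirst_one (i : Fin n) : contractFirst i (1 : FreeAlgebra R (Fin n)) = 0 := by
  have h := basisFreeMonoid_apply (R := R) (n := n) 1
  rw [FreeMonoid.toList_one, List.map_nil, List.prod_nil] at h
  rw [← h]
  exact (FreeAlgebra.basisFreeMonoid R (Fin n)).constr_basis R _ 1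

theorem contractFirst_prod_cons (i j : Fin n) (w : List (Fin n)) :
    contractFirst i ((j :: w).map (FreeAlgebra.ι R)).prod =
      if j = i then (w.map (FreeAlgebra.ι R)).prod else 0 := by
  have h := basisFreeMonoid_apply (R := R) (FreeMonoid.ofList (j :: w))
  rw [FreeMonoid.toList_ofList] at h
  rw [← h]
  exact (FreeAlgebra.basisFreeMonoid R (Fin n)).constr_basis R _ _

theorem contractFirst_algebraMap (i : Fin n) (t : R) :
    contractFirst i (algebraMap R (FreeAlgebra R (Fin n)) t) = 0 := by
  rw [Algebra.algebraMap_eq_smul_one, map_smul, contractFirst_one, smul_zero]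

theorem contractFirst_ι_mul (i j : Fin n) (u : FreeAlgebra R (Fin n)) :
    contractFirst i (FreeAlgebra.ι R j * u) = if j = i then u else 0 := by
  have h : contractFirst i ∘ₗ LinearMap.mulLeft R (FreeAlgebra.ι R j) =
      if j = i then LinearMap.id else 0 := by
    refine (FreeAlgebra.basisFreeMonoid R (Fin n)).ext fun w => ?_
    have h := contractFirst_prod_cons (R := R) i j w.toList
    rw [List.map_cons, List.prod_cons] at h
    rw [LinearMap.comp_apply, LinearMap.mulLeft_apply, basisFreeMonoid_apply, h]
    split_ifs
    · rw [LinearMap.id_apply]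
    · rw [LinearMap.zero_apply]
  have h2 := congrArg (fun φ : FreeAlgebra R (Fin n) →ₗ[R] FreeAlgebra R (Fin n) => φ u) h
  simp only [LinearMap.comp_apply, LinearMap.mulLeft_apply] at h2
  rw [h2]
  split_ifs <;> rfl

theorem contractFirst_ι (i j : Fin n) :
    contractFirst i (FreeAlgebra.ι R j) = if j = i then 1 else 0 := by
  simpa using contractFirst_ι_mul (R := R) i j 1

/-- The first letter of a product comes from `u`, except for the constant term of `u`, which exposes
the first letter of `v`. -/
theorem contractFirst_mul (i : Fin n) (u v : FreeAlgebra R (Fin n)) :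
    contractFirst i (u * v) = contractFirst i u * v + aug R n u • contractFirst i v := by
  induction u using FreeAlgebra.induction generalizing v with
  | grade0 t => simp [contractFirst_algebraMap, ← Algebra.smul_def]
  | grade1 j => simp [contractFirst_ι_mul, contractFirst_ι, aug]
  | mul a b ha hb =>
    rw [mul_assoc, ha, ha, hb, map_mul, add_mul, smul_add, mul_assoc, smul_smul, smul_mul_assoc,
      add_assoc]
  | add a b ha hb =>
    rw [add_mul, map_add, ha, hb, map_add, map_add, add_mul, add_smul]; abel

theorem eq_aug_add_sum (u : FreeAlgebra R (Fin n)) :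
    u = algebraMap R _ (aug R n u) + ∑ j, FreeAlgebra.ι R j * contractFirst j u := by
  induction u using FreeAlgebra.induction with
  | grade0 t => simp [contractFirst_algebraMap]
  | grade1 j => simp [contractFirst_ι, aug]
  | mul a b ha hb =>
    conv_lhs => rw [ha, add_mul]
    conv_lhs => enter [1]; rw [hb]
    simp only [contractFirst_mul, mul_add, Finset.sum_add_distrib, map_mul, Finset.sum_mul,
      Finset.mul_sum, mul_assoc]
    rw [add_assoc, add_comm (∑ j, FreeAlgebra.ι R j * (contractFirst j a * b))]
    simp [Algebra.smul_def, Algebra.left_comm]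
  | add a b ha hb =>
    conv_lhs => rw [ha, hb]
    simp only [map_add, mul_add, Finset.sum_add_distrib]; abel

theorem eq_sum_of_aug {u : FreeAlgebra R (Fin n)} (h : aug R n u = 0) :
    u = ∑ j, FreeAlgebra.ι R j * contractFirst j u := by
  conv_lhs => rw [eq_aug_add_sum u, h, map_zero, zero_add]

theorem contractFirst_toTensor_lie (i : Fin n) (a b : FreeLie R n) :
    contractFirst i (toTensor R n ⁅a, b⁆) =
      contractFirst i (toTensor R n a) * toTensor R n b
        - contractFirst i (toTensor R n b) * toTensor R n a := by
  rw [toTensor_lie, map_sub, contractFirst_mul, contractFirst_mul, aug_toTensor, aug_toTensor]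
  simp

/-- The algebra map `T(H) → T(H) ⊕ ε T(H)`, `xᵢ ↦ xᵢ + ε cᵢ`. -/
def tensorDeform (c : Fin n → FreeAlgebra R (Fin n)) :
    FreeAlgebra R (Fin n) →ₐ[R] DualNumber (FreeAlgebra R (Fin n)) :=
  FreeAlgebra.lift R fun i => TrivSqZeroExt.inl (FreeAlgebra.ι R i) + TrivSqZeroExt.inr (c i)

theorem tensorDeform_fst (c : Fin n → FreeAlgebra R (Fin n)) (u : FreeAlgebra R (Fin n)) :
    (tensorDeform c u).fst = u := by
  have h : (TrivSqZeroExt.fstHom R (FreeAlgebra R (Fin n)) (FreeAlgebra R (Fin n))).comp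
      (tensorDeform c) = AlgHom.id R _ := by
    refine FreeAlgebra.hom_ext (funext fun i => ?_)
    simp [tensorDeform]
  exact congrArg (fun φ : FreeAlgebra R (Fin n) →ₐ[R] FreeAlgebra R (Fin n) => φ u) h

/-- The derivation of `T(H)` with `xᵢ ↦ cᵢ`. -/
def tensorDer (c : Fin n → FreeAlgebra R (Fin n)) :
    FreeAlgebra R (Fin n) →ₗ[R] FreeAlgebra R (Fin n) where
  toFun u := (tensorDeform c u).snd
  map_add' u v := by simp
  map_smul' t u := by simp

theorem tensorDer_ι (c : Fin n → FreeAlgebra R (Fin n)) (i : Fin n) :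
    tensorDer c (FreeAlgebra.ι R i) = c i := by
  change (tensorDeform c _).snd = _
  simp [tensorDeform]

theorem tensorDer_mul (c : Fin n → FreeAlgebra R (Fin n)) (u v : FreeAlgebra R (Fin n)) :
    tensorDer c (u * v) = u * tensorDer c v + tensorDer c u * v := by
  change (tensorDeform c _).snd = _ * (tensorDeform c _).snd + (tensorDeform c _).snd * _
  rw [map_mul, TrivSqZeroExt.snd_mul, tensorDeform_fst, tensorDeform_fst]
  rfl

theorem tensorDer_algebraMap (c : Fin n → FreeAlgebra R (Fin n)) (t : R) :
    tensorDer c (algebraMap R _ t) = 0 := by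
  change (tensorDeform c _).snd = _
  rw [AlgHom.commutes]
  rfl

/-- Apply the derivation D to u = const + ∑ xₖ ∂ₖu: each summand gives cₖ ∂ₖu + xₖ D(∂ₖu). Since cₖ
has no constant term, ∂ⱼ differentiates only the left factor of cₖ ∂ₖu. -/
theorem contractFirst_tensorDer {c : Fin n → FreeAlgebra R (Fin n)}
    (hc : ∀ i, aug R n (c i) = 0) (j : Fin n) (u : FreeAlgebra R (Fin n)) :
    contractFirst j (tensorDer c u) =
      ∑ k, contractFirst j (c k) * contractFirst k u + tensorDer c (contractFirst j u) := by
  conv_lhs => rw [eq_aug_add_sum u]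
  rw [map_add, tensorDer_algebraMap, zero_add]
  simp only [map_sum, tensorDer_mul, tensorDer_ι, map_add, contractFirst_mul, contractFirst_ι, hc,
    aug_ι, zero_smul, add_zero, Finset.sum_add_distrib]
  rw [add_comm]
  simp

theorem toTensor_der (f : FreeLieDer R n) (a : FreeLie R n) :
    toTensor R n (f a) = tensorDer (fun i => toTensor R n (f (gen R i))) (toTensor R n a) := by
  induction a using FreeLie.induction with
  | zero => simp
  | add a b ha hb => simp only [map_add, ha, hb]
  | smul t a ha => simp only [map_smul, ha]
  | of i => rw [toTensor_gen, tensorDer_ι]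
  | lie a b ha hb =>
    rw [LieDerivation.apply_lie_eq_add, map_add, toTensor_lie, toTensor_lie, toTensor_lie, map_sub,
      tensorDer_mul, tensorDer_mul, ha, hb]
    abel

/-- The divergence `∑ᵢ ∂ᵢ(f(xᵢ))` in `T(H)`. -/
def divergence (f : FreeLieDer R n) : FreeAlgebra R (Fin n) :=
  ∑ i, contractFirst i (toTensor R n (f (gen R i)))

/-- The derivation of `T(H)` extending the derivation `f` of `𝓛ₙ`. -/
abbrev extend (f : FreeLieDer R n) : FreeAlgebra R (Fin n) →ₗ[R] FreeAlgebra R (Fin n) :=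
  tensorDer fun i => toTensor R n (f (gen R i))

theorem divergence_comp (f g : FreeLieDer R n) :
    ∑ i, contractFirst i (toTensor R n (f (g (gen R i)))) =
      ∑ i, ∑ k, contractFirst i (toTensor R n (f (gen R k))) *
        contractFirst k (toTensor R n (g (gen R i))) + extend f (divergence g) := by
  rw [divergence, map_sum, ← Finset.sum_add_distrib]
  refine Finset.sum_congr rfl fun i _ => ?_
  rw [toTensor_der f (g (gen R i)), contractFirst_tensorDer fun k => aug_toTensor (f (gen R k))]

/-- By `divergence_comp`, the two compositions contribute the "traces" of the products of the
Jacobian matrices of f and g in the two orders. These agree under τ, and only the derivative terms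
remain. -/
theorem trace_divergence_lie {M : Type*} [AddCommGroup M] [Module R M]
    (τ : FreeAlgebra R (Fin n) →ₗ[R] M) (hτ : ∀ u v, τ (u * v) = τ (v * u))
    (f g : FreeLieDer R n) :
    τ (divergence ⁅f, g⁆) = τ (extend f (divergence g)) - τ (extend g (divergence f)) := by
  have h : divergence ⁅f, g⁆ = ∑ i, contractFirst i (toTensor R n (f (g (gen R i)))) -
      ∑ i, contractFirst i (toTensor R n (g (f (gen R i)))) := by
    simp [divergence]
  rw [h, divergence_comp, divergence_comp, map_sub, map_add, map_add]
  have e : τ (∑ i, ∑ k, contractFirst i (toTensor R n (f (gen R k))) *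
        contractFirst k (toTensor R n (g (gen R i)))) =
      τ (∑ i, ∑ k, contractFirst i (toTensor R n (g (gen R k))) *
        contractFirst k (toTensor R n (f (gen R i)))) := by
    simp only [map_sum]
    rw [Finset.sum_comm]
    exact Finset.sum_congr rfl fun i _ => Finset.sum_congr rfl fun k _ => hτ _ _
  rw [e]; abel

end Calculus

/-! ### The Morita trace: vanishing on brackets and in even degree -/

section MoritaTrace

variable {R : Type*} [CommRing R] {n : ℕ}

theorem eq_zero_of_mem_freeLiePart_zero {a : FreeLie R n} (ha : a ∈ freeLiePart R n 0) : a = 0 := by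
  refine freeLiePart_induction (P := fun k a => k = 0 → a = 0) (fun _ _ => rfl) ?_ ?_ ?_ ?_ ha rfl
  · intro k a b ha hb h; rw [ha h, hb h, add_zero]
  · intro k t a ha h; rw [ha h, smul_zero]
  · intro i h; exact absurd h one_ne_zero
  · intro k a i _ _ h; exact absurd h (Nat.succ_ne_zero k)

theorem toSym_ι (i : Fin n) : toSym R n (FreeAlgebra.ι R i) = MvPolynomial.X i := by simp [toSym]

theorem toSym_toTensor_lie (a b : FreeLie R n) : toSym R n (toTensor R n ⁅a, b⁆) = 0 := by
  rw [toTensor_lie, map_sub, map_mul, map_mul, mul_comm, sub_self]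

theorem toSym_toTensor_eq_zero {k : ℕ} (hk : k ≠ 1) {a : FreeLie R n} (ha : a ∈ freeLiePart R n k) :
    toSym R n (toTensor R n a) = 0 := by
  refine freeLiePart_induction (P := fun k a => k ≠ 1 → toSym R n (toTensor R n a) = 0)
    ?_ ?_ ?_ ?_ ?_ ha hk
  · intro k _; simp
  · intro k a b ha hb h; simp [ha h, hb h]
  · intro k t a ha h; simp [ha h]
  · intro i h; exact absurd rfl h
  · intro k a i _ _ _; exact toSym_toTensor_lie _ _

theorem toSym_toTensor_isHomogeneous {k : ℕ} {a : FreeLie R n} (ha : a ∈ freeLiePart R n k) :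
    (toSym R n (toTensor R n a)).IsHomogeneous k := by
  refine freeLiePart_induction (P := fun k a => (toSym R n (toTensor R n a)).IsHomogeneous k)
    ?_ ?_ ?_ ?_ ?_ ha
  · intro k; simpa using MvPolynomial.isHomogeneous_zero _ _ k
  · intro k a b ha hb; rw [map_add, map_add]; exact ha.add hb
  · intro k t a ha
    rw [map_smul, map_smul]
    exact Submodule.smul_mem (MvPolynomial.homogeneousSubmodule (Fin n) R k) t ha
  · intro i; rw [toTensor_gen, toSym_ι]; exact MvPolynomial.isHomogeneous_X R i
  · intro k a i _ _; rw [toSym_toTensor_lie]; exact MvPolynomial.isHomogeneous_zero _ _ _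

/-- The image in `S(H)` of the contraction of the first factor of a Lie element with `xᵢ*`. -/
def symContract (i : Fin n) : FreeLie R n →ₗ[R] MvPolynomial (Fin n) R where
  toFun a := toSym R n (contractFirst i (toTensor R n a))
  map_add' a b := by simp
  map_smul' t a := by simp

theorem symContract_apply (i : Fin n) (a : FreeLie R n) :
    symContract i a = toSym R n (contractFirst i (toTensor R n a)) := rfl

theorem symContract_gen (i j : Fin n) : symContract (R := R) i (gen R j) =
    if j = i then 1 else 0 := by
  rw [symContract_apply, toTensor_gen, contractFirst_ι]; split_ifs <;> simp

theorem symContract_lie (i : Fin n) (a b : FreeLie R n) :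
    symContract i ⁅a, b⁆ = symContract i a * toSym R n (toTensor R n b)
      - symContract i b * toSym R n (toTensor R n a) := by
  simp only [symContract_apply, contractFirst_toTensor_lie, map_sub, map_mul]

theorem symContract_lie_gen (i j : Fin n) (a : FreeLie R n) :
    symContract i ⁅a, gen R j⁆ = symContract i a * MvPolynomial.X j
      - if j = i then toSym R n (toTensor R n a) else 0 := by
  rw [symContract_lie, symContract_gen, toTensor_gen, toSym_ι]
  split_ifs <;> simp

theorem symContract_isHomogeneous (i : Fin n) {k : ℕ} {a : FreeLie R n}
    (ha : a ∈ freeLiePart R n (k + 1)) : (symContract i a).IsHomogeneous k := by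
  refine freeLiePart_induction
    (P := fun m a => ∀ k, m = k + 1 → (symContract i a).IsHomogeneous k) ?_ ?_ ?_ ?_ ?_ ha k rfl
  · intro m k _; rw [map_zero]; exact MvPolynomial.isHomogeneous_zero _ _ _
  · intro m a b ha hb k hk; rw [map_add]; exact (ha k hk).add (hb k hk)
  · intro m t a ha k hk
    rw [map_smul]
    exact Submodule.smul_mem (MvPolynomial.homogeneousSubmodule (Fin n) R k) t (ha k hk)
  · intro j k hk
    obtain rfl : k = 0 := by omega
    rw [symContract_gen]
    split_ifs
    · exact MvPolynomial.isHomogeneous_one _ _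
    · exact MvPolynomial.isHomogeneous_zero _ _ _
  · intro m a j ha h k hk
    obtain rfl : m = k := by omega
    cases m with
    | zero =>
      rw [eq_zero_of_mem_freeLiePart_zero ha, zero_lie, map_zero]
      exact MvPolynomial.isHomogeneous_zero _ _ _
    | succ m =>
      rw [symContract_lie_gen]
      refine MvPolynomial.IsHomogeneous.sub ((h m rfl).mul (MvPolynomial.isHomogeneous_X R j)) ?_
      split_ifs
      · exact toSym_toTensor_isHomogeneous ha
      · exact MvPolynomial.isHomogeneous_zero _ _ _

theorem moritaTrace_eq (f : FreeLieDer R n) :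
    moritaTrace R n f = ∑ i, symContract i (f (gen R i)) := by
  simp [moritaTrace, symContract_apply]

theorem moritaTrace_isHomogeneous {k : ℕ} {f : FreeLieDer R n} (hf : f ∈ tangentialPart R n k) :
    (moritaTrace R n f).IsHomogeneous k := by
  rw [moritaTrace_eq]
  refine MvPolynomial.IsHomogeneous.sum _ _ _ fun i _ => symContract_isHomogeneous i ?_
  obtain ⟨c, hc, h⟩ := hf i
  rw [h]
  exact lie_gen_mem hc i

/-- The composite is a derivation along T(H) → S(H) that sends each generator to the image of a
commutator, which is zero. -/
theorem toSym_extend {k : ℕ} {f : FreeLieDer R n} (hf : f ∈ tangentialPart R n k)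
    (u : FreeAlgebra R (Fin n)) : toSym R n (extend f u) = 0 := by
  induction u using FreeAlgebra.induction with
  | grade0 t => rw [tensorDer_algebraMap, map_zero]
  | grade1 i =>
    obtain ⟨c, _, h⟩ := hf i
    rw [tensorDer_ι, h, toSym_toTensor_lie]
  | mul a b ha hb => rw [tensorDer_mul, map_add, map_mul, map_mul, ha, hb]; simp
  | add a b ha hb => rw [map_add, map_add, ha, hb, add_zero]

theorem moritaTrace_lie {k l : ℕ} {f g : FreeLieDer R n} (hf : f ∈ tangentialPart R n k)
    (hg : g ∈ tangentialPart R n l) : moritaTrace R n ⁅f, g⁆ = 0 := by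
  have h := trace_divergence_lie (toSym R n).toLinearMap
    (fun u v => by simp [mul_comm]) f g
  simp only [AlgHom.toLinearMap_apply, toSym_extend hf, toSym_extend hg, sub_self] at h
  exact h

/-- The anti-automorphism of `T(H)` with `xᵢ ↦ -xᵢ`. -/
def antipode (R : Type*) [CommRing R] (n : ℕ) :
    FreeAlgebra R (Fin n) →ₗ[R] FreeAlgebra R (Fin n) :=
  (MulOpposite.opLinearEquiv R).symm.toLinearMap ∘ₗ
    (FreeAlgebra.lift R (fun i => MulOpposite.op (-FreeAlgebra.ι R i)) :
      FreeAlgebra R (Fin n) →ₐ[R] (FreeAlgebra R (Fin n))ᵐᵒᵖ).toLinearMap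

theorem antipode_ι (i : Fin n) : antipode R n (FreeAlgebra.ι R i) = -FreeAlgebra.ι R i := by
  simp [antipode]

theorem antipode_mul (u v : FreeAlgebra R (Fin n)) :
    antipode R n (u * v) = antipode R n v * antipode R n u := by
  simp [antipode]

theorem antipode_algebraMap (t : R) :
    antipode R n (algebraMap R _ t) = algebraMap R _ t := by
  simp [antipode, MulOpposite.algebraMap_apply]

theorem antipode_antipode (u : FreeAlgebra R (Fin n)) : antipode R n (antipode R n u) = u := by
  induction u using FreeAlgebra.induction with
  | grade0 t => rw [antipode_algebraMap, antipode_algebraMap]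
  | grade1 i => rw [antipode_ι, map_neg, antipode_ι, neg_neg]
  | mul a b ha hb => rw [antipode_mul, antipode_mul, ha, hb]
  | add a b ha hb => rw [map_add, map_add, ha, hb]

theorem antipode_toTensor (a : FreeLie R n) :
    antipode R n (toTensor R n a) = -toTensor R n a := by
  induction a using FreeLie.induction with
  | zero => simp
  | add a b ha hb => simp [ha, hb, add_comm]
  | smul t a ha => simp [ha]
  | of i => simp [toTensor_gen, antipode_ι]
  | lie a b ha hb =>
    rw [toTensor_lie, map_sub, antipode_mul, antipode_mul, ha, hb]
    noncomm_ring

theorem aeval_neg_X_of_isHomogeneous {k : ℕ} {p : MvPolynomial (Fin n) R}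
    (hp : p.IsHomogeneous k) :
    MvPolynomial.aeval (fun i => -(MvPolynomial.X i : MvPolynomial (Fin n) R)) p =
      (-1) ^ k * p := by
  conv_lhs => rw [p.as_sum]
  conv_rhs => rw [p.as_sum]
  rw [map_sum, Finset.mul_sum]
  refine Finset.sum_congr rfl fun d hd => ?_
  have hk : d.degree = k := by
    rw [Finsupp.degree_eq_weight_one]
    exact hp (MvPolynomial.mem_support_iff.mp hd)
  rw [MvPolynomial.aeval_monomial, MvPolynomial.monomial_eq, MvPolynomial.algebraMap_eq, ← hk,
    Finsupp.degree_apply, ← Finset.prod_pow_eq_pow_sum]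
  simp only [Finsupp.prod, neg_pow (MvPolynomial.X _ : MvPolynomial (Fin n) R),
    Finset.prod_mul_distrib]
  ring

theorem toSym_antipode {k : ℕ} {u : FreeAlgebra R (Fin n)} (hu : (toSym R n u).IsHomogeneous k) :
    toSym R n (antipode R n u) = (-1) ^ k * toSym R n u := by
  rw [← aeval_neg_X_of_isHomogeneous hu]
  -- Homogeneity does not pass to the pieces of the induction. Rewritten as the substitution xᵢ ↦
  -- −xᵢ, the identity holds for every `u`.
  clear hu
  induction u using FreeAlgebra.induction with
  | grade0 t =>
    rw [antipode_algebraMap, AlgHom.commutes, MvPolynomial.algebraMap_eq, MvPolynomial.aeval_C,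
      MvPolynomial.algebraMap_eq]
  | grade1 i => simp [antipode_ι, toSym_ι]
  | mul a b ha hb => rw [antipode_mul, map_mul, map_mul, map_mul, ha, hb, mul_comm]
  | add a b ha hb => simp only [map_add, ha, hb]

/-- The antipode turns last letters into first letters, which `contractFirst` reads off. -/
theorem sum_mul_ι_injective {u v : Fin n → FreeAlgebra R (Fin n)}
    (h : ∑ i, u i * FreeAlgebra.ι R i = ∑ i, v i * FreeAlgebra.ι R i) : u = v := by
  funext j
  have h2 := congrArg (fun w => contractFirst j (antipode R n w)) h
  simp only [map_sum, antipode_mul, antipode_ι,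
    neg_mul, map_neg, contractFirst_ι_mul, Finset.sum_neg_distrib,
    Finset.sum_ite_eq', Finset.mem_univ, if_true, neg_inj] at h2
  rw [← antipode_antipode (u j), h2, antipode_antipode]

/-- Apply ∂ⱼ to the relation: ∂ⱼ[cᵢ, xᵢ] = ∂ⱼ(cᵢ) xᵢ − δᵢⱼ cᵢ. -/
theorem toTensor_eq_sum_contractFirst {c : Fin n → FreeLie R n} (h : ∑ i, ⁅c i, gen R i⁆ = 0)
    (j : Fin n) :
    toTensor R n (c j) = ∑ i, contractFirst j (toTensor R n (c i)) * FreeAlgebra.ι R i := by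
  have h2 := congrArg (fun a => contractFirst j (toTensor R n a)) h
  simp only [map_sum, contractFirst_toTensor_lie, toTensor_gen, contractFirst_ι, map_zero,
    Finset.sum_sub_distrib, ite_mul, one_mul, zero_mul, Finset.sum_ite_eq', Finset.mem_univ,
    if_true, sub_eq_zero] at h2
  exact h2.symm

/-- Two expansions of cⱼ by its last letter are compared: `toTensor_eq_sum_contractFirst`, and the
antipode of cⱼ = ∑ xᵢ ∂ᵢcⱼ, where the sign −1 of the antipode on Lie elements cancels the sign on
xᵢ. -/
theorem antipode_contractFirst {c : Fin n → FreeLie R n} (h : ∑ i, ⁅c i, gen R i⁆ = 0)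
    (i j : Fin n) :
    contractFirst j (toTensor R n (c i)) =
      antipode R n (contractFirst i (toTensor R n (c j))) := by
  have h2 : toTensor R n (c j) =
      ∑ i, antipode R n (contractFirst i (toTensor R n (c j))) * FreeAlgebra.ι R i := by
    rw [← neg_inj, ← antipode_toTensor, eq_sum_of_aug (aug_toTensor (c j))]
    conv_rhs => rw [← eq_sum_of_aug (aug_toTensor (c j))]
    simp [antipode_mul, antipode_ι]
  exact congrFun (sum_mul_ι_injective ((toTensor_eq_sum_contractFirst h j).symm.trans h2)) i

/-- The tensor ∂ᵢcᵢ is fixed by the antipode, while the antipode acts on its image in S(H), of odd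
degree k − 1, by −1. Over ℤ that image is therefore zero. -/
theorem moritaTrace_eq_zero_of_even {n k : ℕ} (hk : Even k) (hk0 : k ≠ 0) {f : FreeLieDer ℤ n}
    (hf : f ∈ specialPart ℤ n k) : moritaTrace ℤ n f = 0 := by
  choose c hc h using hf.1
  have hs := hf.2
  simp only [h] at hs
  rw [moritaTrace_eq]
  refine Finset.sum_eq_zero fun i _ => ?_
  obtain ⟨d, rfl⟩ : ∃ d, k = d + 1 := ⟨k - 1, by omega⟩
  have hd : Odd d := by
    rcases Nat.even_or_odd d with hd | hd
    · exact absurd hk (by simpa [Nat.even_add_one] using hd)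
    · exact hd
  have h1 : symContract i (c i) = 0 := by
    have h2 := toSym_antipode (symContract_isHomogeneous i (hc i))
    rw [← antipode_contractFirst hs i i, hd.neg_one_pow, neg_one_mul] at h2
    exact self_eq_neg.mp h2
  -- Degree one must be excluded because only there can the image of cᵢ in S(H) survive.
  have h3 : d + 1 ≠ 1 := by rintro h; rw [h] at hk; exact absurd hk (by decide)
  rw [h, symContract_lie_gen, h1, toSym_toTensor_eq_zero h3 (hc i)]
  simp

end MoritaTrace

/-! ### Special derivations of degrees one and two -/

section LowDegree

variable {R : Type*} [CommRing R] {n : ℕ}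

theorem freeLiePart_one_le : freeLiePart R n 1 ≤ Submodule.span R (Set.range (gen R (n := n))) := by
  refine Submodule.span_le.mpr ?_
  rintro a ⟨w, hw, rfl⟩
  obtain ⟨i, rfl⟩ := List.length_eq_one_iff.mp hw
  exact Submodule.subset_span ⟨i, by simp [leftNormed]⟩

theorem freeLiePart_two_le : freeLiePart R n 2 ≤
    Submodule.span R (Set.range fun p : Fin n × Fin n => ⁅gen R p.1, gen R p.2⁆) := by
  refine Submodule.span_le.mpr ?_
  rintro a ⟨w, hw, rfl⟩
  obtain ⟨i, j, rfl⟩ := List.length_eq_two.mp hw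
  exact Submodule.subset_span ⟨(i, j), by simp [leftNormed]⟩

/-- The coefficient of `xᵢ` of an element of `T(H)`. -/
def coeffOne (i : Fin n) : FreeAlgebra R (Fin n) →ₗ[R] R :=
  (aug R n).toLinearMap ∘ₗ contractFirst i

/-- The coefficient of `xᵢ xⱼ` of an element of `T(H)`. -/
def coeffTwo (i j : Fin n) : FreeAlgebra R (Fin n) →ₗ[R] R :=
  (aug R n).toLinearMap ∘ₗ contractFirst j ∘ₗ contractFirst i

theorem coeffOne_mul (i : Fin n) (u v : FreeAlgebra R (Fin n)) :
    coeffOne i (u * v) = coeffOne i u * aug R n v + aug R n u * coeffOne i v := by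
  simp [coeffOne, contractFirst_mul]

theorem coeffTwo_mul (i j : Fin n) (u v : FreeAlgebra R (Fin n)) :
    coeffTwo i j (u * v) =
      coeffTwo i j u * aug R n v + coeffOne i u * coeffOne j v + aug R n u * coeffTwo i j v := by
  simp [coeffTwo, coeffOne, contractFirst_mul]

theorem coeffOne_ι (i j : Fin n) :
    coeffOne i (FreeAlgebra.ι R j) = if j = i then 1 else 0 := by
  simp only [coeffOne, LinearMap.comp_apply, contractFirst_ι]
  split_ifs <;> simp

theorem coeffTwo_ι (i j k : Fin n) : coeffTwo i j (FreeAlgebra.ι R k) = 0 := by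
  simp only [coeffTwo, LinearMap.comp_apply, contractFirst_ι]
  split_ifs <;> simp [contractFirst_one]

theorem coeffTwo_toTensor_lie (i j : Fin n) (a b : FreeLie R n) :
    coeffTwo i j (toTensor R n ⁅a, b⁆) =
      coeffOne i (toTensor R n a) * coeffOne j (toTensor R n b)
        - coeffOne i (toTensor R n b) * coeffOne j (toTensor R n a) := by
  simp only [toTensor_lie, map_sub, coeffTwo_mul, aug_toTensor]
  ring

theorem coeffOne_toTensor_lie (i : Fin n) (a b : FreeLie R n) :
    coeffOne i (toTensor R n ⁅a, b⁆) = 0 := by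
  simp only [toTensor_lie, map_sub, coeffOne_mul, aug_toTensor]
  ring

theorem coeffTwo_toTensor_lie_gen (i j k l : Fin n) :
    coeffTwo i j (toTensor R n ⁅gen R k, gen R l⁆) =
      (if k = i then 1 else 0) * (if l = j then 1 else 0)
        - (if l = i then 1 else 0) * (if k = j then 1 else 0) := by
  simp only [coeffTwo_toTensor_lie, toTensor_gen, coeffOne_ι]

/-- The terms at (i, j) and (j, i) cancel. The diagonal needs its own hypothesis because 2 may fail
to be cancellable in M. -/
theorem sum_smul_eq_zero_of_symm {M : Type*} [AddCommGroup M] [Module R M]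
    (γ : Fin n × Fin n → R) (X : Fin n × Fin n → M) (hγ : ∀ i j, γ (i, j) = γ (j, i))
    (hX : ∀ i j, X (i, j) = -X (j, i)) (hX0 : ∀ i, X (i, i) = 0) : ∑ p, γ p • X p = 0 := by
  refine Finset.sum_involution (fun p _ => p.swap) ?_ ?_ (fun _ _ => Finset.mem_univ _) ?_
  · rintro ⟨i, j⟩ _
    rw [Prod.swap_prod_mk, hγ j i, hX j i, smul_neg, add_neg_cancel]
  · rintro ⟨i, j⟩ _ h h2
    obtain rfl : j = i := congrArg Prod.fst h2
    exact h (by rw [hX0, smul_zero])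
  · rintro ⟨i, j⟩ _; rfl

theorem eq_zero_of_coeffTwo {a : FreeLie R n} (ha : a ∈ freeLiePart R n 2)
    (h : ∀ i j, coeffTwo i j (toTensor R n a) = 0) : a = 0 := by
  obtain ⟨r, rfl⟩ := (Submodule.mem_span_range_iff_exists_fun R).mp (freeLiePart_two_le ha)
  refine sum_smul_eq_zero_of_symm r _ (fun i j => ?_) (fun i j => (lie_skew _ _).symm)
    (fun i => lie_self _)
  have h1 := h i j
  simp only [map_sum, map_smul, coeffTwo_toTensor_lie_gen, smul_eq_mul, mul_sub,
    Finset.sum_sub_distrib, Fintype.sum_prod_type] at h1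
  simpa [sub_eq_zero] using h1

theorem coeffTwo_skew {a : FreeLie R n} (ha : a ∈ freeLiePart R n 2) (i j : Fin n) :
    coeffTwo i j (toTensor R n a) = -coeffTwo j i (toTensor R n a) := by
  obtain ⟨r, rfl⟩ := (Submodule.mem_span_range_iff_exists_fun R).mp (freeLiePart_two_le ha)
  simp only [map_sum, map_smul, coeffTwo_toTensor_lie_gen, ← Finset.sum_neg_distrib, ← smul_neg]
  refine Finset.sum_congr rfl fun p _ => ?_
  congr 1
  ring

theorem coeffTwo_self {a : FreeLie R n} (ha : a ∈ freeLiePart R n 2) (i : Fin n) :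
    coeffTwo i i (toTensor R n a) = 0 := by
  obtain ⟨r, rfl⟩ := (Submodule.mem_span_range_iff_exists_fun R).mp (freeLiePart_two_le ha)
  simp only [map_sum, map_smul, coeffTwo_toTensor_lie_gen]
  refine Finset.sum_eq_zero fun p _ => ?_
  rw [mul_comm, sub_self, smul_zero]

theorem eq_sum_lie_of_coeffTwo {a : FreeLie R n} (ha : a ∈ freeLiePart R n 2)
    (w : Fin n → Fin n → R) (h : ∀ i j, w i j - w j i = coeffTwo i j (toTensor R n a)) :
    a = ∑ i, ∑ j, w i j • ⁅gen R i, gen R j⁆ := by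
  rw [← sub_eq_zero]
  refine eq_zero_of_coeffTwo (sub_mem ha (sum_mem fun i _ => sum_mem fun j _ =>
    Submodule.smul_mem _ _ (lie_gen_mem (gen_mem i) j))) fun i j => ?_
  simp only [map_sub, map_sum, map_smul, coeffTwo_toTensor_lie_gen, ← h, smul_eq_mul, mul_sub,
    Finset.sum_sub_distrib]
  simp

theorem eq_sum_of_mem_freeLiePart_one {a : FreeLie R n} (ha : a ∈ freeLiePart R n 1) :
    a = ∑ i, coeffOne i (toTensor R n a) • gen R i := by
  obtain ⟨r, rfl⟩ := (Submodule.mem_span_range_iff_exists_fun R).mp (freeLiePart_one_le ha)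
  simp [toTensor_gen, coeffOne_ι]

theorem coeffOne_symm {c : Fin n → FreeLie R n} (h : ∑ i, ⁅c i, gen R i⁆ = 0) (i j : Fin n) :
    coeffOne i (toTensor R n (c j)) = coeffOne j (toTensor R n (c i)) := by
  rw [toTensor_eq_sum_contractFirst h j]
  simp only [map_sum, coeffOne_mul, coeffOne_ι, aug_ι, mul_zero, zero_add, mul_ite, mul_one,
    Finset.sum_ite_eq', Finset.mem_univ, if_true]
  rfl

/-- In cₖ = ∑ⱼ ∂ₖ(cⱼ) xⱼ, the coefficient of xᵢxⱼ is that of xᵢ in ∂ₖ(cⱼ), hence that of xₖxᵢ in cⱼ.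
-/
theorem coeffTwo_cyclic {c : Fin n → FreeLie R n} (h : ∑ i, ⁅c i, gen R i⁆ = 0) (i j k : Fin n) :
    coeffTwo i j (toTensor R n (c k)) = coeffTwo k i (toTensor R n (c j)) := by
  rw [toTensor_eq_sum_contractFirst h k]
  simp only [map_sum, coeffTwo_mul, coeffOne_ι, coeffTwo_ι, aug_ι, mul_zero, zero_add, mul_ite,
    mul_one, add_zero, Finset.sum_ite_eq', Finset.mem_univ, if_true]
  rfl

theorem dualTensor_gen (i j : Fin n) (a : FreeLie R n) :
    dualTensor i a (gen R j) = if j = i then a else 0 := by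
  rw [dualTensor, derOfGen_gen, Pi.single_apply]

theorem der_sum_apply {ι : Type*} (s : Finset ι) (f : ι → FreeLieDer R n) (a : FreeLie R n) :
    (∑ i ∈ s, f i) a = ∑ i ∈ s, f i a :=
  map_sum (AddMonoidHom.mk' (fun g : FreeLieDer R n => g a) fun _ _ => rfl) f s

/-- The degree one derivation `t_{ij} = xᵢ* ⊗ [xⱼ, xᵢ] + xⱼ* ⊗ [xᵢ, xⱼ]`. -/
def tElt (R : Type*) [CommRing R] {n : ℕ} (i j : Fin n) : FreeLieDer R n :=
  dualTensor i ⁅gen R j, gen R i⁆ + dualTensor j ⁅gen R i, gen R j⁆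

theorem tElt_gen (i j k : Fin n) :
    tElt R i j (gen R k) =
      (if k = i then ⁅gen R j, gen R i⁆ else 0) + if k = j then ⁅gen R i, gen R j⁆ else 0 := by
  rw [tElt, LieDerivation.add_apply, dualTensor_gen, dualTensor_gen]

theorem tElt_mem (i j : Fin n) : tElt R i j ∈ specialPart R n 1 := by
  refine ⟨fun k => ⟨(if k = i then gen R j else 0) + if k = j then gen R i else 0, ?_, ?_⟩, ?_⟩
  · refine add_mem ?_ ?_ <;> split_ifs <;> first | exact gen_mem _ | exact zero_mem _
  · rw [tElt_gen, add_lie]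
    congr 1 <;> split_ifs with h <;> simp [h]
  · simp only [tElt_gen, Finset.sum_add_distrib, Finset.sum_ite_eq', Finset.mem_univ, if_true]
    rw [← lie_skew, neg_add_cancel]

/-- The coefficient matrix of the cⱼ is symmetric by `coeffOne_symm`, and its diagonal is invisible
because [xₖ, xₖ] = 0. The entries above the diagonal therefore determine f. -/
theorem eq_sum_tElt {f : FreeLieDer R n} (hf : f ∈ specialPart R n 1) :
    ∃ r : Fin n → Fin n → R, f = ∑ i, ∑ j, (if i < j then r i j else 0) • tElt R i j := by
  choose c hc h using hf.1
  have hs := hf.2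
  simp only [h] at hs
  refine ⟨fun i j => coeffOne i (toTensor R n (c j)), der_ext fun k => ?_⟩
  have e : ∀ i j, (if i < j then coeffOne i (toTensor R n (c j)) else 0) • tElt R i j (gen R k) =
      (if k = i then (if i < j then coeffOne i (toTensor R n (c j)) else 0) •
        ⁅gen R j, gen R k⁆ else 0) +
      (if k = j then (if i < j then coeffOne i (toTensor R n (c j)) else 0) •
        ⁅gen R i, gen R k⁆ else 0) := by
    intro i j
    rw [tElt_gen, smul_add, smul_ite, smul_ite, smul_zero]
    congr 1 <;> refine if_ctx_congr Iff.rfl (fun h => by rw [h]) fun _ => rfl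
  rw [h, eq_sum_of_mem_freeLiePart_one (hc k)]
  simp only [der_sum_apply, LieDerivation.smul_apply, e,
    Finset.sum_add_distrib]
  rw [Finset.sum_comm]
  simp only [Finset.sum_ite_eq, Finset.mem_univ, if_true, ← Finset.sum_add_distrib,
    sum_lie, smul_lie,
    ← add_smul]
  refine Finset.sum_congr rfl fun j _ => ?_
  rcases lt_trichotomy k j with h1 | rfl | h1
  · rw [if_pos h1, if_neg h1.not_gt, add_zero, coeffOne_symm hs]
  · rw [lie_self, smul_zero, smul_zero]
  · rw [if_pos h1, if_neg h1.not_gt, zero_add]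

theorem specialPart_one_le :
    specialPart R n 1 ≤ Submodule.span R {f | ∃ i j : Fin n, i < j ∧ f = tElt R i j} := by
  intro f hf
  obtain ⟨r, rfl⟩ := eq_sum_tElt hf
  refine sum_mem fun i _ => sum_mem fun j _ => ?_
  split_ifs with h
  · exact Submodule.smul_mem _ _ (Submodule.subset_span ⟨i, j, h, rfl⟩)
  · rw [zero_smul]; exact zero_mem _

theorem lie_tElt_gen {i j k : Fin n} (hij : i ≠ j) (hjk : j ≠ k) (hik : i ≠ k) (m : Fin n) :
    ⁅tElt R i j, tElt R j k⁆ (gen R m) =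
      (if m = i then ⁅⁅gen R j, gen R k⁆, gen R m⁆ else 0) +
      (if m = j then ⁅⁅gen R k, gen R i⁆, gen R m⁆ else 0) +
      if m = k then ⁅⁅gen R i, gen R j⁆, gen R m⁆ else 0 := by
  rw [LieDerivation.commutator_apply, tElt_gen, tElt_gen]
  by_cases h1 : m = i
  · subst h1
    simp [hij, hik, hjk, tElt_gen]
  · by_cases h2 : m = j
    · subst h2
      simp [hjk, hij, hik, hij.symm, hik.symm, hjk.symm, tElt_gen, lie_lie (gen R k)]
    · by_cases h3 : m = k
      · subst h3
        simp [hij.symm, hik.symm, hjk.symm, tElt_gen]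
      · simp [h1, h2, h3]

/-- Such an α is alternating. For distinct indices exactly one of the six orderings is increasing:
an even one contributes α directly, an odd one contributes −α and is subtracted. -/
theorem ordered_sum_eq (α : Fin n → Fin n → Fin n → R) (hcyc : ∀ i j k, α i j k = α k i j)
    (hskew : ∀ i j k, α i j k = -α i k j) (hself : ∀ i j, α i j j = 0) (m j k : Fin n) :
    ((if m < j ∧ j < k then α m j k else 0) + (if k < m ∧ m < j then α k m j else 0) +
      (if j < k ∧ k < m then α j k m else 0)) -
    ((if m < k ∧ k < j then α m k j else 0) + (if j < m ∧ m < k then α j m k else 0) +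
      (if k < j ∧ j < m then α k j m else 0)) = α m j k := by
  have h0 : ∀ i k, α i i k = 0 := fun i k => by rw [hcyc, hself]
  have h1 : ∀ i k, α i k i = 0 := fun i k => by rw [hskew, h0, neg_zero]
  have c1 : α k m j = α m j k := (hcyc m j k).symm
  have c2 : α j k m = α m j k := hcyc j k m
  have c3 : α m k j = -α m j k := hskew m k j
  have c4 : α j m k = -α m j k := by rw [← c3, hcyc m k j]
  have c5 : α k j m = -α m j k := by rw [← c3, hcyc k j m]
  rw [c1, c2, c3, c4, c5]
  rcases lt_trichotomy m j with h | rfl | h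
  · rcases lt_trichotomy j k with h2 | rfl | h2
    · simp [h, h2, h.not_gt, h2.not_gt, (h.trans h2).not_gt]
    · simp [hself]
    · rcases lt_trichotomy m k with h3 | rfl | h3
      · simp [h, h2, h3, h.not_gt, h2.not_gt, h3.not_gt]
      · simp [h1]
      · simp [h, h2, h3, h.not_gt, h2.not_gt, h3.not_gt]
  · simp [h0]
  · rcases lt_trichotomy j k with h2 | rfl | h2
    · rcases lt_trichotomy m k with h3 | rfl | h3
      · simp [h, h2, h3, h.not_gt, h2.not_gt, h3.not_gt]
      · simp [h1]
      · simp [h, h2, h3, h.not_gt, h2.not_gt, h3.not_gt]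
    · simp [hself]
    · simp [h, h2, h.not_gt, h2.not_gt, (h2.trans h).not_gt]

/-- The coefficient α i j k of xⱼxₖ in cᵢ is cyclic, and skew in j, k because cᵢ is a Lie element.
Being alternating, it is matched by the sum of α i j k • [t_{ij}, t_{jk}] over i < j < k. -/
theorem specialPart_two_le :
    specialPart R n 2 ≤ Submodule.span R
      {f | ∃ g ∈ specialPart R n 1, ∃ h ∈ specialPart R n 1, f = ⁅g, h⁆} := by
  intro f hf
  choose c hc h using hf.1
  have hs := hf.2
  simp only [h] at hs
  set α : Fin n → Fin n → Fin n → R := fun i j k => coeffTwo j k (toTensor R n (c i)) with hα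
  set β : Fin n → Fin n → Fin n → R := fun i j k => if i < j ∧ j < k then α i j k else 0 with hβ
  have hcyc : ∀ i j k, α i j k = α k i j := fun i j k => coeffTwo_cyclic hs j k i
  have hskew : ∀ i j k, α i j k = -α i k j := fun i j k => coeffTwo_skew (hc i) j k
  have hself : ∀ i j, α i j j = 0 := fun i j => coeffTwo_self (hc i) j
  have key : f = ∑ i, ∑ j, ∑ k, β i j k • ⁅tElt R i j, tElt R j k⁆ := by
    refine der_ext fun m => ?_
    have e : ∀ i j k, β i j k • ⁅tElt R i j, tElt R j k⁆ (gen R m) =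
        (if m = i then ⁅β m j k • ⁅gen R j, gen R k⁆, gen R m⁆ else 0) +
        (if m = j then ⁅β i m k • ⁅gen R k, gen R i⁆, gen R m⁆ else 0) +
        if m = k then ⁅β i j m • ⁅gen R i, gen R j⁆, gen R m⁆ else 0 := by
      intro i j k
      by_cases hijk : i < j ∧ j < k
      · rw [lie_tElt_gen hijk.1.ne hijk.2.ne (hijk.1.trans hijk.2).ne, smul_add, smul_add]
        simp only [smul_ite, smul_zero, smul_lie]
        refine congrArg₂ _ (congrArg₂ _ ?_ ?_) ?_ <;>
          exact if_ctx_congr Iff.rfl (fun h => by rw [h]) fun _ => rfl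
      -- Here the indices may coincide, so `lie_tElt_gen` is unavailable; each condition m = i, j or
      -- k turns its term into one with this same vanishing coefficient.
      · have h0 : β i j k = 0 := if_neg hijk
        rw [h0, zero_smul]
        split_ifs with h1 h2 h3 h3 h2 h3 h3 <;> subst_vars <;> simp [h0]
    rw [h]
    simp only [der_sum_apply, LieDerivation.smul_apply, e,
      Finset.sum_add_distrib]
    have s1 : ∑ i, ∑ j, ∑ k, (if m = i then ⁅β m j k • ⁅gen R j, gen R k⁆, gen R m⁆ else 0) =
        ⁅∑ j, ∑ k, β m j k • ⁅gen R j, gen R k⁆, gen R m⁆ := by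
      simp only [sum_lie]
      rw [Finset.sum_comm]
      refine Finset.sum_congr rfl fun j _ => ?_
      rw [Finset.sum_comm]
      simp
    have s2 : ∑ i, ∑ j, ∑ k, (if m = j then ⁅β i m k • ⁅gen R k, gen R i⁆, gen R m⁆ else 0) =
        ⁅∑ j, ∑ k, β k m j • ⁅gen R j, gen R k⁆, gen R m⁆ := by
      simp only [sum_lie]
      rw [Finset.sum_comm (γ := Fin n) (f := fun j k => ⁅β k m j • ⁅gen R j, gen R k⁆, gen R m⁆)]
      refine Finset.sum_congr rfl fun i _ => ?_
      rw [Finset.sum_comm]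
      simp
    have s3 : ∑ i, ∑ j, ∑ k, (if m = k then ⁅β i j m • ⁅gen R i, gen R j⁆, gen R m⁆ else 0) =
        ⁅∑ j, ∑ k, β j k m • ⁅gen R j, gen R k⁆, gen R m⁆ := by
      simp only [sum_lie]
      simp
    rw [s1, s2, s3, ← add_lie, ← add_lie]
    congr 1
    simp only [← Finset.sum_add_distrib, ← add_smul]
    refine eq_sum_lie_of_coeffTwo (hc m) (fun j k => β m j k + β k m j + β j k m) fun j k => ?_
    exact ordered_sum_eq α hcyc hskew hself m j k
  rw [key]
  exact sum_mem fun i _ => sum_mem fun j _ => sum_mem fun k _ => Submodule.smul_mem _ _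
    (Submodule.subset_span ⟨_, tElt_mem i j, _, tElt_mem j k, rfl⟩)

/-- Write g through brackets [s, t] of degree one elements and use [f, [s, t]] = [[f, s], t] − [[f,
t], s]. -/
theorem lie_mem_bracketSpan_of_two {k : ℕ} {f g : FreeLieDer R n} (hf : f ∈ specialPart R n k)
    (hg : g ∈ specialPart R n 2) : ⁅f, g⁆ ∈ bracketSpan R n (k + 1) 1 := by
  replace hg := specialPart_two_le hg
  induction hg using Submodule.span_induction with
  | mem x hx =>
    obtain ⟨s, hs, t, ht, rfl⟩ := hx
    have e : ⁅f, ⁅s, t⁆⁆ = ⁅⁅f, s⁆, t⁆ - ⁅⁅f, t⁆, s⁆ := by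
      rw [leibniz_lie, ← lie_skew ⁅f, t⁆ s]; abel
    rw [e]
    exact sub_mem (Submodule.subset_span ⟨_, lie_specialPart_mem hf hs, _, ht, rfl⟩)
      (Submodule.subset_span ⟨_, lie_specialPart_mem hf ht, _, hs, rfl⟩)
  | zero => rw [lie_zero]; exact zero_mem _
  | add x y _ _ hx hy => rw [lie_add]; exact add_mem hx hy
  | smul t x _ hx => rw [lie_smul]; exact Submodule.smul_mem _ _ hx

end LowDegree

/-! ### The image of the first Johnson homomorphism -/

section Johnson

/-- The integral Heisenberg group, of matrices `[[1, a, c], [0, 1, b], [0, 0, 1]]`. -/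
@[ext] structure Heis where
  a : ℤ
  b : ℤ
  c : ℤ

namespace Heis

instance : Mul Heis := ⟨fun x y => ⟨x.a + y.a, x.b + y.b, x.c + y.c + x.a * y.b⟩⟩
instance : One Heis := ⟨⟨0, 0, 0⟩⟩
instance : Inv Heis := ⟨fun x => ⟨-x.a, -x.b, x.a * x.b - x.c⟩⟩

@[simp] theorem mul_a (x y : Heis) : (x * y).a = x.a + y.a := rfl
@[simp] theorem mul_b (x y : Heis) : (x * y).b = x.b + y.b := rfl
@[simp] theorem mul_c (x y : Heis) : (x * y).c = x.c + y.c + x.a * y.b := rfl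
@[simp] theorem one_a : (1 : Heis).a = 0 := rfl
@[simp] theorem one_b : (1 : Heis).b = 0 := rfl
@[simp] theorem one_c : (1 : Heis).c = 0 := rfl
@[simp] theorem inv_a (x : Heis) : x⁻¹.a = -x.a := rfl
@[simp] theorem inv_b (x : Heis) : x⁻¹.b = -x.b := rfl
@[simp] theorem inv_c (x : Heis) : x⁻¹.c = x.a * x.b - x.c := rfl

instance : Group Heis :=
  Group.ofLeftAxioms (fun x y z => by ext <;> simp <;> ring) (fun x => by ext <;> simp)
    (fun x => by ext <;> simp)

end Heis

variable {n : ℕ}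

/-- The homomorphism `Fₙ → Heis` that records the coefficients of `xᵢ`, `xⱼ` and `xᵢ xⱼ` in the
Magnus expansion. -/
def toHeis (i j : Fin n) : FreeGroup (Fin n) →* Heis :=
  FreeGroup.lift fun k => ⟨if k = i then 1 else 0, if k = j then 1 else 0, 0⟩

theorem toHeis_of (i j k : Fin n) :
    toHeis i j (FreeGroup.of k) = ⟨if k = i then 1 else 0, if k = j then 1 else 0, 0⟩ := by
  simp [toHeis]

theorem toHeis_of_mem_lcs_one (i j : Fin n) {w : FreeGroup (Fin n)}
    (hw : w ∈ (⊤ : Subgroup (FreeGroup (Fin n))).lowerCentralSeries 1) :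
    (toHeis i j w).a = 0 ∧ (toHeis i j w).b = 0 := by
  let K : Subgroup (FreeGroup (Fin n)) :=
    { carrier := {w | (toHeis i j w).a = 0 ∧ (toHeis i j w).b = 0}
      mul_mem' := by rintro v w ⟨h1, h2⟩ ⟨h3, h4⟩; simp [h1, h2, h3, h4]
      one_mem' := by simp
      inv_mem' := by rintro v ⟨h1, h2⟩; simp [h1, h2] }
  have h : (⊤ : Subgroup (FreeGroup (Fin n))).lowerCentralSeries 1 ≤ K := by
    rw [Subgroup.lowerCentralSeries_succ, Subgroup.lowerCentralSeries_zero, Subgroup.commutator_le]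
    intro v _ w _
    change (toHeis i j ⁅v, w⁆).a = 0 ∧ (toHeis i j ⁅v, w⁆).b = 0
    simp [commutatorElement_def]
  exact h hw

/-- Γₙ(2) maps to elements with a = b = 0, which are central in the Heisenberg group. -/
theorem toHeis_of_mem_lcs_two (i j : Fin n) {w : FreeGroup (Fin n)}
    (hw : w ∈ (⊤ : Subgroup (FreeGroup (Fin n))).lowerCentralSeries 2) : toHeis i j w = 1 := by
  have h : (⊤ : Subgroup (FreeGroup (Fin n))).lowerCentralSeries 2 ≤ (toHeis i j).ker := by
    rw [Subgroup.lowerCentralSeries_succ, Subgroup.commutator_le]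
    intro v hv w _
    obtain ⟨h1, h2⟩ := toHeis_of_mem_lcs_one i j hv
    rw [MonoidHom.mem_ker]
    ext <;> simp [commutatorElement_def, h1, h2]
  exact h hw

theorem Represents.mem {k : ℕ} {w : FreeGroup (Fin n)} {a : FreeLie ℤ n} (h : Represents n k w a) :
    1 ≤ k ∧ a ∈ freeLiePart ℤ n k := by
  induction h with
  | of i => exact ⟨le_rfl, gen_mem i⟩
  | ker k hk w _ => exact ⟨hk, zero_mem _⟩
  | mul k v w a b _ _ h1 h2 => exact ⟨h1.1, add_mem h1.2 h2.2⟩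
  | inv k v a _ h1 => exact ⟨h1.1, neg_mem h1.2⟩
  | comm k l v w a b _ _ h1 h2 => exact ⟨by omega, lie_mem h1.2 h2.2⟩

/-- The coordinate c is not additive in degree one, so it is compared only for k ≥ 2, where a and b
vanish. The commutator case uses only the degree one coordinates: c of a commutator is a b′ − a′ b.
-/
theorem Represents.toHeis_eq {k : ℕ} {w : FreeGroup (Fin n)} {a : FreeLie ℤ n}
    (h : Represents n k w a) (i j : Fin n) :
    (toHeis i j w).a = coeffOne i (toTensor ℤ n a) ∧
    (toHeis i j w).b = coeffOne j (toTensor ℤ n a) ∧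
    (2 ≤ k → coeffOne i (toTensor ℤ n a) = 0 ∧ coeffOne j (toTensor ℤ n a) = 0) ∧
    (2 ≤ k → (toHeis i j w).c = coeffTwo i j (toTensor ℤ n a)) := by
  induction h with
  | of k =>
    refine ⟨?_, ?_, fun h => absurd h (by norm_num), fun h => absurd h (by norm_num)⟩ <;>
      rw [toTensor_gen, coeffOne_ι, toHeis_of]
  | ker k hk w hw =>
    have h1 := toHeis_of_mem_lcs_one i j (Subgroup.lowerCentralSeries_antitone ⊤ hk hw)
    refine ⟨by simp [h1.1], by simp [h1.2], by simp, fun h => ?_⟩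
    rw [toHeis_of_mem_lcs_two i j (Subgroup.lowerCentralSeries_antitone ⊤ h hw)]
    simp
  | mul k v w a b _ _ h1 h2 =>
    obtain ⟨p1, q1, r1, s1⟩ := h1
    obtain ⟨p2, q2, r2, s2⟩ := h2
    refine ⟨by simp [p1, p2], by simp [q1, q2], fun h => ?_, fun h => ?_⟩
    · simp [r1 h, r2 h]
    · simp [s1 h, s2 h, p1, r1 h]
  | inv k v a _ h1 =>
    obtain ⟨p1, q1, r1, s1⟩ := h1
    refine ⟨by simp [p1], by simp [q1], fun h => ?_, fun h => ?_⟩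
    · simp [r1 h]
    · simp [s1 h, p1, r1 h]
  | comm k l v w a b _ _ h1 h2 =>
    obtain ⟨p1, q1, -, -⟩ := h1
    obtain ⟨p2, q2, -, -⟩ := h2
    simp only [coeffOne_toTensor_lie, coeffTwo_toTensor_lie, ← p1, ← p2, ← q1, ← q2]
    refine ⟨by simp [commutatorElement_def], by simp [commutatorElement_def], by simp,
      fun _ => ?_⟩
    simp [commutatorElement_def]
    ring

/-- Makes the relation single-valued in degree two: a Lie element there is determined by its
coefficients on xᵢxⱼ, which `toHeis` reads from the group element. -/
theorem Represents.unique {w : FreeGroup (Fin n)} {a b : FreeLie ℤ n} (ha : Represents n 2 w a)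
    (hb : Represents n 2 w b) : a = b := by
  rw [← sub_eq_zero]
  refine eq_zero_of_coeffTwo (sub_mem ha.mem.2 hb.mem.2) fun i j => ?_
  rw [map_sub, map_sub, ← (ha.toHeis_eq i j).2.2.2 le_rfl, ← (hb.toHeis_eq i j).2.2.2 le_rfl,
    sub_self]

theorem Represents.one_exists (w : FreeGroup (Fin n)) : ∃ a, Represents n 1 w a := by
  induction w using FreeGroup.induction_on with
  | C1 => exact ⟨0, Represents.ker 1 le_rfl _ (one_mem _)⟩
  | of i => exact ⟨_, Represents.of i⟩
  | inv_of i h => exact ⟨_, Represents.inv 1 _ _ (Represents.of i)⟩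
  | mul v w hv hw =>
    obtain ⟨a, ha⟩ := hv
    obtain ⟨b, hb⟩ := hw
    exact ⟨_, Represents.mul 1 _ _ _ _ ha hb⟩

theorem Represents.displacement {σ : MulAut (FreeGroup (Fin n))} {i : Fin n}
    {c : FreeGroup (Fin n)} (h : σ (FreeGroup.of i) = c * FreeGroup.of i * c⁻¹) {a : FreeLie ℤ n}
    (hc : Represents n 1 c a) : Represents n 2 (displacement σ i) ⁅a, gen ℤ i⁆ := by
  have h1 := Represents.comm 1 1 _ _ _ _ (Represents.inv 1 _ _ (Represents.of i)) hc
  rw [neg_lie, lie_skew] at h1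
  rwa [SpecialDer.displacement, h, show (FreeGroup.of i)⁻¹ * (c * FreeGroup.of i * c⁻¹) =
    ⁅(FreeGroup.of i)⁻¹, c⁆ by rw [commutatorElement_def]; group]

/-- Each d k has central image, so these factors can be collected at the end of the product, where
their c coordinates add up. -/
theorem toHeis_prod_mul (i j : Fin n) (L : List (Fin n)) (x d : Fin n → FreeGroup (Fin n))
    (hd : ∀ k, (toHeis i j (d k)).a = 0 ∧ (toHeis i j (d k)).b = 0) :
    toHeis i j (L.map fun k => x k * d k).prod =
      toHeis i j (L.map x).prod * ⟨0, 0, (L.map fun k => (toHeis i j (d k)).c).sum⟩ := by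
  induction L with
  | nil => ext <;> simp
  | cons k L ih =>
    rw [List.map_cons, List.prod_cons, map_mul, ih]
    obtain ⟨h1, h2⟩ := hd k
    ext <;> simp [h1, h2]
    ring

/-- Since σ fixes x₁⋯xₙ, the product of the xₖ · (xₖ⁻¹σ(xₖ)) equals that of the xₖ. In every
Heisenberg quotient the c coordinates of the displacements then sum to zero, which is ∑ yₖ = 0
coefficientwise. -/
theorem exists_specialPart_of_mem_imTauOne {y : Fin n → FreeLie ℤ n} (hy : y ∈ imTauOne n) :
    ∃ f ∈ specialPart ℤ n 1, ∀ i, f (gen ℤ i) = y i := by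
  obtain ⟨σ, hσ, h⟩ := hy
  choose c hc using hσ.1
  choose a ha using fun i => Represents.one_exists (c i)
  have hya : ∀ i, y i = ⁅a i, gen ℤ i⁆ := fun i =>
    (h i).unique (Represents.displacement (hc i) (ha i))
  refine ⟨derOfGen y, ⟨fun i => ⟨a i, (ha i).mem.2, by rw [derOfGen_gen, hya]⟩, ?_⟩,
    fun i => derOfGen_gen y i⟩
  simp only [derOfGen_gen]
  refine eq_zero_of_coeffTwo (sum_mem fun i _ => (h i).mem.2) fun i j => ?_
  have h1 := toHeis_prod_mul i j (List.finRange n) FreeGroup.of (displacement σ)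
    fun k => toHeis_of_mem_lcs_one i j (displacement_mem hσ k)
  have h2 : (List.finRange n).map (fun k => FreeGroup.of k * displacement σ k) =
      ((List.finRange n).map FreeGroup.of).map σ := by
    rw [List.map_map]
    exact List.map_congr_left fun k _ => by simp [displacement]
  have h3 := hσ.2
  rw [List.ofFn_eq_map, map_list_prod, ← h2] at h3
  rw [h3] at h1
  have h4 := congrArg Heis.c (mul_left_cancel ((mul_one _).trans h1))
  simp only [Heis.one_c, ← List.ofFn_eq_map, List.sum_ofFn] at h4
  rw [map_sum, map_sum, h4]
  exact Finset.sum_congr rfl fun k _ => ((h k).toHeis_eq i j).2.2.2 le_rfl |>.symm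

theorem map_prod_of_fixed (φ : FreeGroup (Fin n) →* FreeGroup (Fin n)) {L : List (Fin n)}
    (h : ∀ k ∈ L, φ (FreeGroup.of k) = FreeGroup.of k) :
    φ (L.map FreeGroup.of).prod = (L.map FreeGroup.of).prod := by
  rw [map_list_prod, List.map_map]
  exact congrArg _ (List.map_congr_left h)

/-- The endomorphism of `Fₙ` that conjugates `xᵢ` by `c` and `xⱼ` by `d`. -/
def conjTwo (i j : Fin n) (c d : FreeGroup (Fin n)) : FreeGroup (Fin n) →* FreeGroup (Fin n) :=
  FreeGroup.lift fun k => if k = i then c * FreeGroup.of i * c⁻¹ else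
    if k = j then d * FreeGroup.of j * d⁻¹ else FreeGroup.of k

theorem conjTwo_left (i j : Fin n) (c d : FreeGroup (Fin n)) :
    conjTwo i j c d (FreeGroup.of i) = c * FreeGroup.of i * c⁻¹ := by simp [conjTwo]

theorem conjTwo_right {i j : Fin n} (h : i ≠ j) (c d : FreeGroup (Fin n)) :
    conjTwo i j c d (FreeGroup.of j) = d * FreeGroup.of j * d⁻¹ := by simp [conjTwo, h.symm]

theorem conjTwo_other {i j k : Fin n} (hi : k ≠ i) (hj : k ≠ j) (c d : FreeGroup (Fin n)) :
    conjTwo i j c d (FreeGroup.of k) = FreeGroup.of k := by simp [conjTwo, hi, hj]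

theorem finRange_split {i j : Fin n} (h : i < j) :
    ∃ L₁ L₂ L₃ : List (Fin n), List.finRange n = L₁ ++ i :: (L₂ ++ j :: L₃) ∧
      (∀ k ∈ L₁, k ≠ i ∧ k ≠ j) ∧ (∀ k ∈ L₂, k ≠ i ∧ k ≠ j) ∧ ∀ k ∈ L₃, k ≠ i ∧ k ≠ j := by
  obtain ⟨L₁, L, hL⟩ := List.append_of_mem (List.mem_finRange i)
  have hp := List.pairwise_lt_finRange n
  rw [hL, List.pairwise_append, List.pairwise_cons] at hp
  obtain ⟨-, ⟨h1, h2⟩, h3⟩ := hp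
  have hj : j ∈ L := by
    have hj := List.mem_finRange j
    rw [hL, List.mem_append, List.mem_cons] at hj
    rcases hj with hj | rfl | hj
    · exact absurd (h3 j hj i (by simp)) h.not_gt
    · exact absurd h (lt_irrefl _)
    · exact hj
  obtain ⟨L₂, L₃, rfl⟩ := List.append_of_mem hj
  rw [List.pairwise_append, List.pairwise_cons] at h2
  obtain ⟨-, ⟨h4, h5⟩, h6⟩ := h2
  refine ⟨L₁, L₂, L₃, hL, fun k hk => ?_, fun k hk => ?_, fun k hk => ?_⟩
  · exact ⟨(h3 k hk i (by simp)).ne, (h3 k hk j (by simp)).ne⟩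
  · exact ⟨(h1 k (by simp [hk])).ne', (h6 k hk j (by simp)).ne⟩
  · exact ⟨(h1 k (by simp [hk])).ne', (h4 k hk).ne'⟩

/-- The braid is a standard pure braid generator: with m the product of the generators strictly
between xᵢ and xⱼ, it conjugates both xᵢ and m xⱼ m⁻¹ by their product and fixes the other
generators. Hence xᵢ m xⱼ is fixed. -/
theorem tElt_mem_imTauOne {i j : Fin n} (h : i < j) :
    (fun k => tElt ℤ i j (gen ℤ k)) ∈ imTauOne n := by
  obtain ⟨L₁, L₂, L₃, hL, h1, h2, h3⟩ := finRange_split h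
  set m : FreeGroup (Fin n) := (L₂.map FreeGroup.of).prod with hm
  set a : FreeGroup (Fin n) := FreeGroup.of i with ha
  set b : FreeGroup (Fin n) := FreeGroup.of j with hb
  set φ := conjTwo i j (a * m * b * m⁻¹) (m⁻¹ * a * m) with hφ
  -- As φ fixes the conjugator a · mbm⁻¹, its inverse conjugates a and mbm⁻¹ by the inverse of that
  -- element. Rewriting this for b, and dropping a power of b that commutes with it, gives the
  -- second conjugator.
  set ψ := conjTwo i j (a * m * b * m⁻¹)⁻¹ (b⁻¹ * m⁻¹ * a⁻¹ * m) with hψ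
  have φa : φ a = (a * m * b * m⁻¹) * a * (a * m * b * m⁻¹)⁻¹ := conjTwo_left _ _ _ _
  have φb : φ b = (m⁻¹ * a * m) * b * (m⁻¹ * a * m)⁻¹ := conjTwo_right h.ne _ _
  have φo : ∀ k, k ≠ i ∧ k ≠ j → φ (FreeGroup.of k) = FreeGroup.of k := fun k hk =>
    conjTwo_other hk.1 hk.2 _ _
  have φm : φ m = m := map_prod_of_fixed φ fun k hk => φo k (h2 k hk)
  have ψa : ψ a = (a * m * b * m⁻¹)⁻¹ * a * (a * m * b * m⁻¹)⁻¹⁻¹ := conjTwo_left _ _ _ _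
  have ψb : ψ b = (b⁻¹ * m⁻¹ * a⁻¹ * m) * b * (b⁻¹ * m⁻¹ * a⁻¹ * m)⁻¹ := conjTwo_right h.ne _ _
  have ψo : ∀ k, k ≠ i ∧ k ≠ j → ψ (FreeGroup.of k) = FreeGroup.of k := fun k hk =>
    conjTwo_other hk.1 hk.2 _ _
  have ψm : ψ m = m := map_prod_of_fixed ψ fun k hk => ψo k (h2 k hk)
  have hψφ : ψ.comp φ = MonoidHom.id _ := by
    refine FreeGroup.ext_hom _ _ fun k => ?_
    rw [MonoidHom.comp_apply, MonoidHom.id_apply]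
    by_cases hki : k = i
    · subst hki
      rw [← ha, φa]
      simp only [map_mul, map_inv, ψa, ψb, ψm]
      group
    · by_cases hkj : k = j
      · subst hkj
        rw [← hb, φb]
        simp only [map_mul, map_inv, ψa, ψb, ψm]
        group
      · rw [φo k ⟨hki, hkj⟩, ψo k ⟨hki, hkj⟩]
  have hφψ : φ.comp ψ = MonoidHom.id _ := by
    refine FreeGroup.ext_hom _ _ fun k => ?_
    rw [MonoidHom.comp_apply, MonoidHom.id_apply]
    by_cases hki : k = i
    · subst hki
      rw [← ha, ψa]
      simp only [map_mul, map_inv, φa, φb, φm]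
      group
    · by_cases hkj : k = j
      · subst hkj
        rw [← hb, ψb]
        simp only [map_mul, map_inv, φa, φb, φm]
        group
      · rw [ψo k ⟨hki, hkj⟩, φo k ⟨hki, hkj⟩]
  have hσ : ∀ w, (MonoidHom.toMulEquiv φ ψ hψφ hφψ : MulAut _) w = φ w := fun w => rfl
  refine ⟨MonoidHom.toMulEquiv φ ψ hψφ hφψ, ⟨fun k => ?_, ?_⟩, fun k => ?_⟩
  · rw [hσ]
    by_cases hki : k = i
    · subst hki; exact ⟨_, φa⟩
    · by_cases hkj : k = j
      · subst hkj; exact ⟨_, φb⟩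
      · exact ⟨1, by rw [φo k ⟨hki, hkj⟩]; group⟩
  · rw [hσ, List.ofFn_eq_map, hL]
    simp only [List.map_append, List.map_cons, List.prod_append, List.prod_cons, map_mul,
      ← ha, ← hb, ← hm, φa, φb, φm, map_prod_of_fixed φ fun k hk => φo k (h1 k hk),
      map_prod_of_fixed φ fun k hk => φo k (h3 k hk)]
    group
  · obtain ⟨M, hM⟩ := Represents.one_exists m
    have rc := Represents.mul 1 _ _ _ _ (Represents.mul 1 _ _ _ _ (Represents.mul 1 _ _ _ _
      (Represents.of i) hM) (Represents.of j)) (Represents.inv 1 _ _ hM)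
    have rd := Represents.mul 1 _ _ _ _ (Represents.mul 1 _ _ _ _ (Represents.inv 1 _ _ hM)
      (Represents.of i)) hM
    -- Modulo Γₙ(2) the factor m cancels: the conjugators have classes xᵢ + xⱼ and xᵢ, and [xᵢ + xⱼ,
    -- xᵢ] = [xⱼ, xᵢ].
    rw [show gen ℤ i + M + gen ℤ j + -M = gen ℤ i + gen ℤ j by abel] at rc
    rw [show -M + gen ℤ i + M = gen ℤ i by abel] at rd
    dsimp only
    rw [tElt_gen]
    by_cases hki : k = i
    · subst hki
      rw [if_pos rfl, if_neg h.ne, add_zero]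
      have := Represents.displacement (σ := MonoidHom.toMulEquiv φ ψ hψφ hφψ) φa rc
      simpa using this
    · by_cases hkj : k = j
      · subst hkj
        rw [if_pos rfl, if_neg h.ne', zero_add]
        have := Represents.displacement (σ := MonoidHom.toMulEquiv φ ψ hψφ hφψ) φb rd
        simpa using this
      · rw [if_neg hki, if_neg hkj, add_zero]
        refine Represents.ker 2 (by norm_num) _ ?_
        rw [displacement, hσ, φo k ⟨hki, hkj⟩, inv_mul_cancel]
        exact one_mem _

theorem specialPart_one_mem_imTauOne {f : FreeLieDer ℤ n} (hf : f ∈ specialPart ℤ n 1) :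
    (fun i => f (gen ℤ i)) ∈ imTauOne n := by
  replace hf := specialPart_one_le hf
  induction hf using Submodule.span_induction with
  | mem x hx =>
    obtain ⟨i, j, h, rfl⟩ := hx
    exact tElt_mem_imTauOne h
  | zero => exact zero_mem _
  | add x y _ _ hx hy => exact add_mem hx hy
  | smul t x _ hx => exact zsmul_mem hx t

end Johnson

/-! ### The elements 𝐛 and 𝐧, and a functional that detects 𝐧(1,2,3) -/

section ExplicitElements

variable {R : Type*} [CommRing R] {n : ℕ}

theorem lie_lie_sub_lie_lie {L : Type*} [LieRing L] (u v w : L) :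
    ⁅⁅u, v⁆, w⁆ - ⁅⁅u, w⁆, v⁆ = ⁅u, ⁅v, w⁆⁆ := by
  rw [leibniz_lie u v w, ← lie_skew v ⁅u, w⁆]; abel

theorem dualTensor_mem {i : Fin n} {k : ℕ} {c : FreeLie R n} (hc : c ∈ freeLiePart R n k) :
    dualTensor i ⁅c, gen R i⁆ ∈ tangentialPart R n k := by
  intro j
  by_cases h : j = i
  · subst h; exact ⟨c, hc, by rw [dualTensor_gen, if_pos rfl]⟩
  · exact ⟨0, zero_mem _, by rw [dualTensor_gen, if_neg h, zero_lie]⟩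

/-- With B = [[r, q], p] and C = [[i, j], l], two uses of Jacobi collapse the first three terms to
[B, C] and the last three to [C, B]. -/
theorem lie_identity_bElt {L : Type*} [LieRing L] (i j l p q r : L) :
    ⁅⁅⁅⁅⁅r, q⁆, p⁆, l⁆, j⁆, i⁆ - ⁅⁅⁅⁅⁅r, q⁆, p⁆, l⁆, i⁆, j⁆ - ⁅⁅⁅⁅r, q⁆, p⁆, ⁅j, i⁆⁆, l⁆
      - ⁅⁅⁅⁅i, j⁆, l⁆, ⁅q, r⁆⁆, p⁆ - ⁅⁅⁅⁅⁅i, j⁆, l⁆, p⁆, r⁆, q⁆ + ⁅⁅⁅⁅⁅i, j⁆, l⁆, p⁆, q⁆, r⁆ = 0 := by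
  have e1 := lie_lie_sub_lie_lie ⁅⁅⁅r, q⁆, p⁆, l⁆ j i
  have e2 := lie_lie_sub_lie_lie ⁅⁅r, q⁆, p⁆ l ⁅j, i⁆
  have e3 := lie_lie_sub_lie_lie ⁅⁅⁅i, j⁆, l⁆, p⁆ q r
  have e4 := lie_lie_sub_lie_lie ⁅⁅i, j⁆, l⁆ p ⁅q, r⁆
  have s1 : ⁅l, ⁅j, i⁆⁆ = ⁅⁅i, j⁆, l⁆ := by rw [← lie_skew, ← lie_skew i, neg_lie]
  have s2 : ⁅p, ⁅q, r⁆⁆ = ⁅⁅r, q⁆, p⁆ := by rw [← lie_skew, ← lie_skew r, neg_lie]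
  rw [s1] at e2
  rw [s2, ← lie_skew ⁅⁅i, j⁆, l⁆ ⁅⁅r, q⁆, p⁆] at e4
  rw [← e1, sub_eq_iff_eq_add] at e2
  rw [← e3, sub_eq_iff_eq_add] at e4
  rw [e2, sub_eq_iff_eq_add.mp e4, add_sub_cancel_right]
  generalize ⁅⁅⁅⁅⁅i, j⁆, l⁆, p⁆, r⁆, q⁆ = x
  generalize ⁅⁅⁅r, q⁆, p⁆, ⁅⁅i, j⁆, l⁆⁆ = y
  generalize ⁅⁅⁅⁅i, j⁆, l⁆, ⁅q, r⁆⁆, p⁆ = z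
  abel

theorem bElt_eq (i j l p q r : Fin n) : bElt R i j l p q r =
    dualTensor i ⁅⁅⁅⁅⁅gen R r, gen R q⁆, gen R p⁆, gen R l⁆, gen R j⁆, gen R i⁆
    - dualTensor j ⁅⁅⁅⁅⁅gen R r, gen R q⁆, gen R p⁆, gen R l⁆, gen R i⁆, gen R j⁆
    - dualTensor l ⁅⁅⁅⁅gen R r, gen R q⁆, gen R p⁆, ⁅gen R j, gen R i⁆⁆, gen R l⁆
    - dualTensor p ⁅⁅⁅⁅gen R i, gen R j⁆, gen R l⁆, ⁅gen R q, gen R r⁆⁆, gen R p⁆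
    - dualTensor q ⁅⁅⁅⁅⁅gen R i, gen R j⁆, gen R l⁆, gen R p⁆, gen R r⁆, gen R q⁆
    + dualTensor r ⁅⁅⁅⁅⁅gen R i, gen R j⁆, gen R l⁆, gen R p⁆, gen R q⁆, gen R r⁆ := by
  simp only [bElt, leftNormed, List.foldl_cons, List.foldl_nil]

theorem bElt_mem (i j l p q r : Fin n) : bElt R i j l p q r ∈ specialPart R n 5 := by
  have h2 : ∀ a b : Fin n, ⁅gen R a, gen R b⁆ ∈ freeLiePart R n 2 := fun a b =>
    lie_gen_mem (k := 1) (gen_mem a) b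
  have h3 : ∀ a b c : Fin n, ⁅⁅gen R a, gen R b⁆, gen R c⁆ ∈ freeLiePart R n 3 := fun a b c =>
    lie_gen_mem (k := 2) (h2 a b) c
  have h5 : ∀ a b c d e : Fin n, ⁅⁅⁅⁅gen R a, gen R b⁆, gen R c⁆, gen R d⁆, gen R e⁆ ∈
      freeLiePart R n 5 := fun a b c d e =>
    lie_gen_mem (k := 4) (lie_gen_mem (k := 3) (h3 a b c) d) e
  have h5' : ∀ a b c d e : Fin n, ⁅⁅⁅gen R a, gen R b⁆, gen R c⁆, ⁅gen R d, gen R e⁆⁆ ∈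
      freeLiePart R n 5 := fun a b c d e => lie_mem (k := 3) (l := 2) (h3 a b c) (h2 d e)
  rw [bElt_eq]
  refine ⟨?_, ?_⟩
  · exact add_mem (sub_mem (sub_mem (sub_mem (sub_mem (dualTensor_mem (h5 r q p l j))
      (dualTensor_mem (h5 r q p l i))) (dualTensor_mem (h5' r q p j i)))
      (dualTensor_mem (h5' i j l q r))) (dualTensor_mem (h5 i j l p r)))
      (dualTensor_mem (h5 i j l p q))
  · simp only [LieDerivation.add_apply, LieDerivation.sub_apply, dualTensor_gen,
      Finset.sum_add_distrib, Finset.sum_sub_distrib, Finset.sum_ite_eq', Finset.mem_univ, if_true]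
    exact lie_identity_bElt _ _ _ _ _ _

theorem nElt_mem (i j l : Fin n) : nElt R i j l ∈ specialPart R n 5 :=
  sub_mem (bElt_mem _ _ _ _ _ _) (bElt_mem _ _ _ _ _ _)

theorem moritaTrace_dualTensor (i : Fin n) (a : FreeLie R n) :
    moritaTrace R n (dualTensor i a) = symContract i a := by
  rw [moritaTrace_eq, Finset.sum_eq_single i]
  · rw [dualTensor_gen, if_pos rfl]
  · intro j _ h; rw [dualTensor_gen, if_neg h, map_zero]
  · intro h; exact absurd (Finset.mem_univ i) h

theorem moritaTrace_nElt {i j l : Fin n} (hij : i ≠ j) (hjl : j ≠ l) (hil : i ≠ l) :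
    moritaTrace R n (nElt R i j l) = 0 := by
  simp only [nElt, bElt_eq, map_sub, map_add, moritaTrace_dualTensor, symContract_lie,
    symContract_gen, toSym_toTensor_lie, toTensor_gen, toSym_ι,
    hij, hjl, hil, hij.symm, hjl.symm, hil.symm, if_true, if_false]
  ring

/-- The matrices `1, E₁₂, E₂₁, 0, 0, …`. -/
def testMatrix (R : Type*) [CommRing R] {n : ℕ} (i : Fin n) : Matrix (Fin 2) (Fin 2) R :=
  if i.val = 0 then 1 else if i.val = 1 then !![0, 1; 0, 0] else
    if i.val = 2 then !![0, 0; 1, 0] else 0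

/-- The representation of `T(H)` with `xᵢ ↦ testMatrix R i`. -/
def testRep (R : Type*) [CommRing R] (n : ℕ) : FreeAlgebra R (Fin n) →ₐ[R]
    Matrix (Fin 2) (Fin 2) R :=
  FreeAlgebra.lift R (testMatrix R)

theorem testRep_ι (i : Fin n) : testRep R n (FreeAlgebra.ι R i) = testMatrix R i := by
  simp [testRep]

/-- The trace of a tensor in the representation `testRep`. -/
def testTrace (R : Type*) [CommRing R] (n : ℕ) : FreeAlgebra R (Fin n) →ₗ[R] R :=
  Matrix.traceLinearMap (Fin 2) R R ∘ₗ (testRep R n).toLinearMap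

theorem testTrace_apply (u : FreeAlgebra R (Fin n)) :
    testTrace R n u = (testRep R n u).trace := rfl

theorem testTrace_mul_comm (u v : FreeAlgebra R (Fin n)) :
    testTrace R n (u * v) = testTrace R n (v * u) := by
  rw [testTrace_apply, testTrace_apply, map_mul, map_mul, Matrix.trace_mul_comm]

theorem divergence_tElt {i j : Fin n} (h : i ≠ j) :
    divergence (tElt R i j) = -(FreeAlgebra.ι R i + FreeAlgebra.ι R j) := by
  simp only [divergence, tElt_gen, map_add, Finset.sum_add_distrib, apply_ite (toTensor R n),
    apply_ite (contractFirst _), map_zero, Finset.sum_ite_eq', Finset.mem_univ, if_true,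
    contractFirst_toTensor_lie, toTensor_gen, contractFirst_ι, h, h.symm, if_false]
  simp

/-- It suffices to find S on generators. As x₁ ↦ 1 is central and all generators after x₃ go to 0,
the images of xᵢ and xⱼ commute unless they are E₁₂ and E₂₁; apart from that pair S = 0 works. -/
theorem testRep_tElt {i j : Fin n} (h : i < j) :
    ∃ S, ∀ u, testRep R n (extend (tElt R i j) u) = S * testRep R n u - testRep R n u * S := by
  have key : ∃ S : Matrix (Fin 2) (Fin 2) R, ∀ k,
      testRep R n (toTensor R n (tElt R i j (gen R k))) = S * testMatrix R k - testMatrix R k * S := by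
    by_cases hij : i.val = 1 ∧ j.val = 2
    -- On xᵢ and xⱼ the derivation t_{ij} is the bracket with xᵢ + xⱼ; the remaining generators go
    -- to scalar matrices, which commute with S.
    · refine ⟨testMatrix R i + testMatrix R j, fun k => ?_⟩
      rw [tElt_gen, map_add, map_add, apply_ite (toTensor R n), apply_ite (toTensor R n),
        apply_ite (testRep R n), apply_ite (testRep R n)]
      simp only [toTensor_lie, toTensor_gen, map_sub, map_mul, testRep_ι, map_zero]
      by_cases hki : k = i
      · subst hki
        rw [if_pos rfl, if_neg h.ne]
        noncomm_ring
      · by_cases hkj : k = j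
        · subst hkj
          rw [if_pos rfl, if_neg hki]
          noncomm_ring
        · have h1 : k.val ≠ 1 := fun e => hki (Fin.ext (by omega))
          have h2 : k.val ≠ 2 := fun e => hkj (Fin.ext (by omega))
          rw [if_neg hki, if_neg hkj]
          by_cases h0 : k.val = 0 <;> simp [testMatrix, h0, h1, h2]
    · refine ⟨0, fun k => ?_⟩
      have hc : testMatrix R i * testMatrix R j = testMatrix R j * testMatrix R i := by
        by_cases h0 : i.val = 0
        · have : testMatrix R i = 1 := by simp [testMatrix, h0]
          rw [this, one_mul, mul_one]
        · have hlt : i.val < j.val := h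
          have : testMatrix R j = 0 := by
            rw [testMatrix, if_neg (by omega), if_neg (by omega), if_neg (by omega)]
          rw [this, mul_zero, zero_mul]
      rw [tElt_gen, map_add, map_add, apply_ite (toTensor R n), apply_ite (toTensor R n),
        apply_ite (testRep R n), apply_ite (testRep R n)]
      simp only [toTensor_lie, toTensor_gen, map_sub, map_mul, testRep_ι, map_zero, hc, sub_self,
        ite_self, zero_mul, mul_zero, add_zero]
  obtain ⟨S, hS⟩ := key
  refine ⟨S, fun u => ?_⟩
  induction u using FreeAlgebra.induction with
  | grade0 t =>
    rw [tensorDer_algebraMap, map_zero, AlgHom.commutes, Algebra.commutes, sub_self]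
  | grade1 k => rw [tensorDer_ι, hS, testRep_ι]
  | mul a b ha hb => rw [tensorDer_mul, map_add, map_mul, map_mul, ha, hb, map_mul]; noncomm_ring
  | add a b ha hb => rw [map_add, map_add, ha, hb, map_add]; noncomm_ring

/-- The linear functional `f ↦ tr(ρ(div f))`, for the representation `ρ = testRep`. -/
def testFunctional (R : Type*) [CommRing R] (n : ℕ) : FreeLieDer R n →ₗ[R] R where
  toFun f := testTrace R n (divergence f)
  map_add' f g := by simp [divergence, Finset.sum_add_distrib]
  map_smul' t f := by
    simp only [divergence, LieDerivation.smul_apply, map_smul, ← Finset.smul_sum, RingHom.id_apply]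

/-- Take g = t_{ij}. Then div g = −(xᵢ + xⱼ), and f sends each generator to a commutator, of trace
zero. The other term is the trace of [S, ρ(div f)], also zero. -/
theorem testFunctional_lie {k : ℕ} {f g : FreeLieDer R n} (hf : f ∈ specialPart R n k)
    (hg : g ∈ specialPart R n 1) : testFunctional R n ⁅f, g⁆ = 0 := by
  replace hg := specialPart_one_le hg
  induction hg using Submodule.span_induction with
  | mem x hx =>
    obtain ⟨i, j, h, rfl⟩ := hx
    refine (trace_divergence_lie (testTrace R n) testTrace_mul_comm f (tElt R i j)).trans ?_
    rw [divergence_tElt h.ne]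
    obtain ⟨S, hS⟩ := testRep_tElt (R := R) h
    have h1 : ∀ i, testTrace R n (extend f (FreeAlgebra.ι R i)) = 0 := by
      intro i
      obtain ⟨c, -, hc⟩ := hf.1 i
      rw [tensorDer_ι, hc, toTensor_lie, map_sub, testTrace_mul_comm, sub_self]
    rw [map_neg, map_add, map_neg, map_add, h1, h1, testTrace_apply, hS, Matrix.trace_sub,
      Matrix.trace_mul_comm]
    simp
  | zero => rw [lie_zero, map_zero]
  | add x y _ _ hx hy => rw [lie_add, map_add, hx, hy, add_zero]
  | smul t x _ hx => rw [lie_smul, map_smul, hx, smul_zero]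

theorem testFunctional_eq_zero {k : ℕ} {f : FreeLieDer R n} (hf : f ∈ bracketSpan R n k 1) :
    testFunctional R n f = 0 := by
  have h : bracketSpan R n k 1 ≤ LinearMap.ker (testFunctional R n) := by
    refine Submodule.span_le.mpr ?_
    rintro _ ⟨f, hf, g, hg, rfl⟩
    exact testFunctional_lie hf hg
  exact h hf

/-- The image of a Lie element under `testRep`. -/
def testValue (a : FreeLie R n) : Matrix (Fin 2) (Fin 2) R := testRep R n (toTensor R n a)

/-- The image under `testRep` of the contraction of a Lie element with `xᵢ*`. -/
def testContract (i : Fin n) (a : FreeLie R n) : Matrix (Fin 2) (Fin 2) R :=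
  testRep R n (contractFirst i (toTensor R n a))

theorem testValue_gen (i : Fin n) : testValue (gen R i) = testMatrix R i := by
  rw [testValue, toTensor_gen, testRep_ι]

theorem testValue_lie (a b : FreeLie R n) :
    testValue ⁅a, b⁆ = testValue a * testValue b - testValue b * testValue a := by
  simp only [testValue, toTensor_lie, map_sub, map_mul]

theorem testContract_gen (i j : Fin n) :
    testContract i (gen R j) = if j = i then 1 else 0 := by
  rw [testContract, toTensor_gen, contractFirst_ι]
  split_ifs <;> simp

theorem testContract_lie (i : Fin n) (a b : FreeLie R n) :
    testContract i ⁅a, b⁆ = testContract i a * testValue b - testContract i b * testValue a := by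
  simp only [testContract, testValue, contractFirst_toTensor_lie, map_sub, map_mul]

theorem testFunctional_dualTensor (i : Fin n) (a : FreeLie R n) :
    testFunctional R n (dualTensor i a) = (testContract i a).trace := by
  change testTrace R n (divergence _) = _
  rw [testTrace_apply, divergence, Finset.sum_eq_single i]
  · rw [dualTensor_gen, if_pos rfl, testContract]
  · intro j _ h; rw [dualTensor_gen, if_neg h, map_zero, map_zero]
  · intro h; exact absurd (Finset.mem_univ i) h

theorem testFunctional_n123 (hn : 3 ≤ n) : testFunctional ℤ n (n123 n hn) = 2 := by
  have h0 : testMatrix ℤ (⟨0, by omega⟩ : Fin n) = 1 := rfl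
  have h1 : testMatrix ℤ (⟨1, by omega⟩ : Fin n) = !![0, 1; 0, 0] := rfl
  have h2 : testMatrix ℤ (⟨2, by omega⟩ : Fin n) = !![0, 0; 1, 0] := rfl
  simp only [n123, nElt, bElt_eq, map_sub, map_add, testFunctional_dualTensor, testContract_lie,
    testValue_lie, testContract_gen, testValue_gen, Fin.mk.injEq, h0, h1, h2]
  simp [Matrix.trace_fin_two, Matrix.one_fin_two]

theorem n123_notMem_bracketSpan (hn : 3 ≤ n) (k : ℕ) : n123 n hn ∉ bracketSpan ℤ n k 1 := by
  intro h
  have := testFunctional_eq_zero h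
  rw [testFunctional_n123] at this
  exact absurd this two_ne_zero

end ExplicitElements

/-! ### The abelianization, its degree five part and the map induced by Θ -/

section Abelianization

variable {R : Type*} [CommRing R] {n : ℕ}

theorem special_induction {P : FreeLieDer R n → Prop} (zero : P 0)
    (add : ∀ f g, P f → P g → P (f + g)) (part : ∀ k, ∀ f ∈ specialPart R n (k + 1), P f)
    {f : FreeLieDer R n} (hf : f ∈ special R n) : P f :=
  Submodule.iSup_induction (fun k : ℕ => specialPart R n (k + 1)) (motive := P) hf part zero add

/-- Bilinearity reduces membership of all brackets to brackets of homogeneous elements. -/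
theorem specialCommutator_le {W : Submodule R (FreeLieDer R n)}
    (hW : ∀ k l, ∀ f ∈ specialPart R n (k + 1), ∀ g ∈ specialPart R n (l + 1), ⁅f, g⁆ ∈ W)
    {h : special R n} (hh : h ∈ specialCommutator R n) : (h : FreeLieDer R n) ∈ W := by
  have h1 : (specialCommutator R n).toSubmodule ≤ W.comap (special R n).toSubmodule.subtype := by
    rw [LieSubmodule.lieIdeal_oper_eq_linear_span, Submodule.span_le]
    rintro _ ⟨⟨f, _⟩, ⟨g, _⟩, rfl⟩
    change ⁅(f : FreeLieDer R n), (g : FreeLieDer R n)⁆ ∈ W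
    refine special_induction (P := fun f => ⁅f, (g : FreeLieDer R n)⁆ ∈ W) ?_ ?_ ?_ f.2
    · rw [zero_lie]; exact zero_mem _
    · intro a b ha hb; rw [add_lie]; exact add_mem ha hb
    · intro k a ha
      refine special_induction (P := fun g => ⁅a, g⁆ ∈ W) ?_ ?_ ?_ g.2
      · rw [lie_zero]; exact zero_mem _
      · intro b c hb hc; rw [lie_add]; exact add_mem hb hc
      · intro l b hb; exact hW k l a ha b hb
  exact h1 hh

theorem toH1_eq_zero_iff (f : special R n) : toH1 R n f = 0 ↔ f ∈ specialCommutator R n :=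
  LieSubmodule.Quotient.mk_eq_zero' (N := specialCommutator R n)

theorem toH1_surjective : Function.Surjective (toH1 R n) :=
  LieSubmodule.Quotient.surjective_mk' (specialCommutator R n)

theorem apply_gen_mem {k : ℕ} {f : FreeLieDer R n} (hf : f ∈ specialPart R n k) (i : Fin n) :
    f (gen R i) ∈ freeLiePart R n (k + 1) := by
  obtain ⟨c, hc, h⟩ := hf.1 i
  rw [h]
  exact lie_gen_mem hc i

/-- The values on the generators of the degree `k` part of a derivation. -/
def gradedValues (R : Type*) [CommRing R] (n k : ℕ) : FreeLieDer R n →ₗ[R] Fin n → FreeLie R n where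
  toFun f i := freeLieProj R n (k + 1) (f (gen R i))
  map_add' f g := by ext i; simp
  map_smul' t f := by ext i; simp

theorem gradedValues_of_mem {k l : ℕ} {f : FreeLieDer R n} (hf : f ∈ specialPart R n l) (i : Fin n) :
    gradedValues R n k f i = if l = k then f (gen R i) else 0 := by
  change freeLieProj R n (k + 1) (f (gen R i)) = _
  rw [freeLieProj_apply_of_mem (apply_gen_mem hf i)]
  exact if_congr (by omega) rfl rfl

theorem bracketSpan_le {k l m : ℕ} (h : k + l = m) : bracketSpan R n k l ≤ specialPart R n m := by
  refine Submodule.span_le.mpr ?_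
  rintro _ ⟨f, hf, g, hg, rfl⟩
  rw [← h]
  exact lie_specialPart_mem hf hg

/-- Up to skew symmetry the bidegree is (4, 1) or (3, 2), and the latter is absorbed by
`lie_mem_bracketSpan_of_two`. -/
theorem lie_mem_bracketSpan_four_one {k l : ℕ} (h : k + 1 + (l + 1) = 5) {f g : FreeLieDer R n}
    (hf : f ∈ specialPart R n (k + 1)) (hg : g ∈ specialPart R n (l + 1)) :
    ⁅f, g⁆ ∈ bracketSpan R n 4 1 := by
  have hk : k ≤ 3 := by omega
  interval_cases k
  · obtain rfl : l = 3 := by omega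
    rw [← lie_skew]
    exact neg_mem (Submodule.subset_span ⟨g, hg, f, hf, rfl⟩)
  · obtain rfl : l = 2 := by omega
    rw [← lie_skew]
    exact neg_mem (lie_mem_bracketSpan_of_two hg hf)
  · obtain rfl : l = 1 := by omega
    exact lie_mem_bracketSpan_of_two hf hg
  · obtain rfl : l = 0 := by omega
    exact Submodule.subset_span ⟨f, hf, g, hg, rfl⟩

theorem mem_bracketSpan_of_mem_specialCommutator {f : special R n}
    (hf : (f : FreeLieDer R n) ∈ specialPart R n 5) (h : f ∈ specialCommutator R n) :
    (f : FreeLieDer R n) ∈ bracketSpan R n 4 1 := by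
  have h1 : (f : FreeLieDer R n) ∈
      -- This submodule is `bracketSpan R n 4 1` enlarged by the kernel of the degree 5 projection,
      -- so brackets of every other total degree lie in it too. The projection is injective on
      -- 𝔟ₙ(5), which removes the enlargement for f.
      ((bracketSpan R n 4 1).map (gradedValues R n 5)).comap (gradedValues R n 5) := by
    refine specialCommutator_le (fun k l a ha b hb => ?_) h
    by_cases hkl : k + 1 + (l + 1) = 5
    · exact ⟨_, lie_mem_bracketSpan_four_one hkl ha hb, rfl⟩
    · have : gradedValues R n 5 ⁅a, b⁆ = 0 := by
        ext i
        rw [gradedValues_of_mem (lie_specialPart_mem ha hb), if_neg hkl, Pi.zero_apply]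
      rw [Submodule.mem_comap, this]
      exact zero_mem _
  obtain ⟨g, hg, hgf⟩ := h1
  have hg5 := bracketSpan_le (m := 5) rfl hg
  have : g = f := der_ext fun i => by
    have := congrFun hgf i
    rwa [gradedValues_of_mem hg5, gradedValues_of_mem hf, if_pos rfl, if_pos rfl] at this
  rwa [← this]

theorem bracketSpan_le_specialCommutator {f : special R n}
    (h : (f : FreeLieDer R n) ∈ bracketSpan R n 4 1) : f ∈ specialCommutator R n := by
  have h1 : bracketSpan R n 4 1 ≤
      (specialCommutator R n).toSubmodule.map (special R n).toSubmodule.subtype := by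
    refine Submodule.span_le.mpr ?_
    rintro _ ⟨a, ha, b, hb, rfl⟩
    exact ⟨⁅(⟨a, specialPart_le n 4 (by norm_num) ha⟩ : special R n),
      (⟨b, specialPart_le n 1 le_rfl hb⟩ : special R n)⁆,
      LieSubmodule.lie_mem_lie (LieSubmodule.mem_top _) (LieSubmodule.mem_top _), rfl⟩
  obtain ⟨g, hg, hgf⟩ := h1 h
  have : g = f := Subtype.ext hgf
  rwa [← this]

theorem ker_partToH1_five : LinearMap.ker (partToH1 R n 5 (by norm_num)) =
    (bracketSpan R n 4 1).comap (specialPart R n 5).subtype := by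
  ext f
  rw [LinearMap.mem_ker, Submodule.mem_comap]
  change toH1 R n _ = 0 ↔ _
  rw [toH1_eq_zero_iff]
  exact ⟨fun h => mem_bracketSpan_of_mem_specialCommutator f.2 h,
    fun h => bracketSpan_le_specialCommutator h⟩

theorem Theta_of_one {f : FreeLieDer R n} (hf : f ∈ specialPart R n 1) :
    Theta R n f = (fun i => f (gen R i), 0) := by
  have h := moritaTrace_isHomogeneous hf.1
  refine Prod.ext ?_ ?_
  · funext i
    change freeLieProj R n 2 _ = _
    rw [freeLieProj_apply_of_mem (apply_gen_mem hf i), if_pos rfl]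
  · change moritaTrace R n f - _ - _ = 0
    rw [MvPolynomial.homogeneousComponent_of_mem h, MvPolynomial.homogeneousComponent_of_mem h]
    simp

theorem Theta_of_ne_one {k : ℕ} (hk0 : k ≠ 0) (hk : k ≠ 1) {f : FreeLieDer R n}
    (hf : f ∈ specialPart R n k) : Theta R n f = (0, moritaTrace R n f) := by
  have h := moritaTrace_isHomogeneous hf.1
  refine Prod.ext ?_ ?_
  · funext i
    change freeLieProj R n 2 _ = 0
    rw [freeLieProj_apply_of_mem (apply_gen_mem hf i), if_neg (by omega)]
  · change moritaTrace R n f - _ - _ = moritaTrace R n f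
    rw [MvPolynomial.homogeneousComponent_of_mem h, MvPolynomial.homogeneousComponent_of_mem h,
      if_neg hk0.symm, if_neg hk.symm, sub_zero, sub_zero]

/-- Brackets of elements of 𝔟ₙ have degree at least two, where Θ is the Morita trace. -/
theorem Theta_of_mem_specialCommutator {f : special R n} (hf : f ∈ specialCommutator R n) :
    Theta R n f = 0 := by
  refine specialCommutator_le (W := LinearMap.ker (Theta R n)) (fun k l a ha b hb => ?_) hf
  rw [LinearMap.mem_ker, Theta_of_ne_one (by omega) (by omega) (lie_specialPart_mem ha hb),
    moritaTrace_lie ha.1 hb.1]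
  rfl

/-- The map induced by `Θ` on `H₁(𝔟ₙ, R)`. -/
def thetaH1 (R : Type*) [CommRing R] (n : ℕ) :
    H1 R n →ₗ[R] (Fin n → FreeLie R n) × MvPolynomial (Fin n) R :=
  Submodule.liftQ (specialCommutator R n).toSubmodule
    (Theta R n ∘ₗ (special R n).toSubmodule.subtype)
    fun _ hf => Theta_of_mem_specialCommutator hf

theorem Theta_mem_thetaTarget (f : special ℤ n) : Theta ℤ n f ∈ thetaTarget n := by
  refine special_induction (P := fun f => Theta ℤ n f ∈ thetaTarget n) ?_ ?_ ?_ f.2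
  · rw [map_zero]; exact zero_mem _
  · intro f g hf hg; rw [map_add]; exact add_mem hf hg
  · intro k f hf
    cases k with
    | zero =>
      rw [Theta_of_one hf]
      exact ⟨specialPart_one_mem_imTauOne hf, zero_mem _⟩
    | succ k =>
      rw [Theta_of_ne_one (by omega) (by omega) hf]
      refine ⟨zero_mem _, ?_⟩
      rcases Nat.even_or_odd (k + 1 + 1) with hk | hk
      · rw [moritaTrace_eq_zero_of_even hk (by omega) hf]; exact zero_mem _
      · obtain ⟨m, hm⟩ := hk
        obtain ⟨m, rfl⟩ : ∃ d, m = d + 1 := ⟨m - 1, by omega⟩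
        rw [hm] at hf
        exact Submodule.mem_iSup_of_mem (p := fun m => imMT ℤ n (2 * (m + 1) + 1)) m ⟨f, hf, rfl⟩

theorem exists_Theta_eq {y : (Fin n → FreeLie ℤ n) × MvPolynomial (Fin n) ℤ}
    (hy : y ∈ thetaTarget n) : ∃ f : special ℤ n, Theta ℤ n f = y := by
  obtain ⟨h1, h2⟩ := hy
  obtain ⟨f, hf, hfy⟩ := exists_specialPart_of_mem_imTauOne h1
  have h3 : ∃ g : special ℤ n, Theta ℤ n g = (0, y.2) := by
    refine Submodule.iSup_induction (fun m => imMT ℤ n (2 * (m + 1) + 1))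
      (motive := fun p => ∃ g : special ℤ n, Theta ℤ n g = (0, p)) h2 ?_ ?_ ?_
    · rintro m _ ⟨g, hg, rfl⟩
      exact ⟨⟨g, specialPart_le n _ (by omega) hg⟩, Theta_of_ne_one (by omega) (by omega) hg⟩
    · exact ⟨0, map_zero _⟩
    · rintro p q ⟨g, hg⟩ ⟨h, hh⟩
      refine ⟨g + h, (map_add (Theta ℤ n) (g : FreeLieDer ℤ n) h).trans ?_⟩
      rw [hg, hh, Prod.mk_add_mk, add_zero]
  obtain ⟨g, hg⟩ := h3
  refine ⟨⟨f, specialPart_le n 1 le_rfl hf⟩ + g, ?_⟩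
  refine (map_add (Theta ℤ n) f (g : FreeLieDer ℤ n)).trans ?_
  rw [hg, Theta_of_one hf]
  refine Prod.ext (funext fun i => ?_) ?_
  · simp [hfy]
  · simp

/-- The map induced by `Θ` from `H₁(𝔟ₙ, ℤ)` to `Im(τ₁ᴮ) ⊕ ⨁ₘ Im(MTᴮ_{2m+1})`. -/
def thetaBar (n : ℕ) : H1 ℤ n →+ thetaTarget n :=
  (thetaH1 ℤ n).toAddMonoidHom.codRestrict (thetaTarget n) fun x => by
    obtain ⟨f, rfl⟩ := toH1_surjective x
    exact Theta_mem_thetaTarget f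

theorem thetaBar_toH1 (f : special ℤ n) :
    (thetaBar n (toH1 ℤ n f) : (Fin n → FreeLie ℤ n) × MvPolynomial (Fin n) ℤ) = Theta ℤ n f := rfl

theorem thetaBar_surjective : Function.Surjective (thetaBar n) := by
  rintro ⟨y, hy⟩
  obtain ⟨f, hf⟩ := exists_Theta_eq hy
  exact ⟨toH1 ℤ n f, Subtype.ext hf⟩

theorem n123_mem (hn : 3 ≤ n) : n123 n hn ∈ specialPart ℤ n 5 := nElt_mem _ _ _

theorem moritaTrace_n123 (hn : 3 ≤ n) : moritaTrace ℤ n (n123 n hn) = 0 :=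
  moritaTrace_nElt (by simp) (by simp) (by simp)

/-- The class of 𝐧(1,2,3) goes to zero. Were it zero in H₁, the element would be a degree 5 member
of the commutator ideal, hence in [𝔟ₙ(4), 𝔟ₙ(1)], where the test functional vanishes. -/
theorem thetaBar_not_injective (hn : 3 ≤ n) : ¬ Function.Injective (thetaBar n) := by
  intro h
  let f : special ℤ n := ⟨n123 n hn, specialPart_le n 5 (by norm_num) (n123_mem hn)⟩
  have h1 : thetaBar n (toH1 ℤ n f) = thetaBar n 0 := by
    rw [map_zero]
    refine Subtype.ext ?_
    rw [thetaBar_toH1, Theta_of_ne_one (by norm_num) (by norm_num) (n123_mem hn),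
      moritaTrace_n123 hn]
    rfl
  exact n123_notMem_bracketSpan hn 4 (mem_bracketSpan_of_mem_specialCommutator (n123_mem hn)
    ((toH1_eq_zero_iff f).mp (h h1)))

end Abelianization

end SpecialDer

end

theorem theorem1p3 (n : ℕ) (hn : 3 ≤ n) :
    (∃ ThetaBar : SpecialDer.H1 ℤ n →+ SpecialDer.thetaTarget n,
      (∀ f : SpecialDer.special ℤ n,
        (ThetaBar (SpecialDer.toH1 ℤ n f) :
          (Fin n → SpecialDer.FreeLie ℤ n) × MvPolynomial (Fin n) ℤ) =
            SpecialDer.Theta ℤ n (f : SpecialDer.FreeLieDer ℤ n)) ∧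
      Function.Surjective ThetaBar ∧ ¬ Function.Injective ThetaBar) ∧
    (SpecialDer.n123 n hn ∈ SpecialDer.specialPart ℤ n 5 ∧
      SpecialDer.n123 n hn ≠ 0 ∧
      SpecialDer.moritaTrace ℤ n (SpecialDer.n123 n hn) = 0 ∧
      SpecialDer.n123 n hn ∉ SpecialDer.bracketSpan ℤ n 4 1) ∧
    (SpecialDer.bracketSpan ℤ n 4 1 ≤ SpecialDer.specialPart ℤ n 5 ∧
      ∃ e : (SpecialDer.specialPart ℤ n 5 ⧸
          (SpecialDer.bracketSpan ℤ n 4 1).comap (SpecialDer.specialPart ℤ n 5).subtype) ≃+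
            SpecialDer.H1Part ℤ n 5 (by norm_num),
        ∀ f : SpecialDer.specialPart ℤ n 5,
          (e (Submodule.Quotient.mk f) : SpecialDer.H1 ℤ n) =
            SpecialDer.partToH1 ℤ n 5 (by norm_num) f) := by
  refine ⟨⟨SpecialDer.thetaBar n, SpecialDer.thetaBar_toH1, SpecialDer.thetaBar_surjective,
    SpecialDer.thetaBar_not_injective hn⟩, ⟨SpecialDer.n123_mem hn, fun h => ?_,
    SpecialDer.moritaTrace_n123 hn, SpecialDer.n123_notMem_bracketSpan hn 4⟩,
    SpecialDer.bracketSpan_le rfl, ?_⟩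
  · exact SpecialDer.n123_notMem_bracketSpan hn 4 (h ▸ zero_mem _)
  · exact ⟨((Submodule.quotEquivOfEq _ _ SpecialDer.ker_partToH1_five.symm).trans
      (SpecialDer.partToH1 ℤ n 5 (by norm_num)).quotKerEquivRange).toAddEquiv, fun f => rfl⟩
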